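/- **Theorem 3.3 (Convergence of the M-scheme).** Let $d\ge 1$ and let $\Omega\subset\mathbb R^d$ be a bounded domain. Write $\|\cdot\|$ and $(\cdot,\cdot)$ for the norm and inner product of $L^2(\Omega)$, and $\mathcal Z=L^2(\Omega)\times L^2(\Omega)\times H^1_0(\Omega)$. For a Lipschitz function $g:\mathbb R\to\mathbb R$, $[g]_{\rm Lip}$ denotes its smallest Lipschitz constant. *Nonlinearities.* Let $\omega=1$ or $\omega=\infty$. (A.1a) $\Phi:[0,\omega)\to[0,\infty)$ is locally Lipschitz and strictly increasing on $(0,\omega)$, $\Phi(0)=0$, and either $\Phi'(0)>0$ or $\Phi$ is convex in a right neighbourhood of $0$. Put $\Phi_{\rm M}=\lim_{u\nearrow\omega}\Phi(u)$; if $\Phi_{\rm M}<\infty$ and $\omega<\infty$, then $\Phi$ is extended at $u=\omega$ by the multivalued value $[\Phi_{\rm M},\infty)$. (B) $\Phi$ is differentiable on $(0,\omega)$ with locally Lipschitz derivative, and there is $u^*\in(0,\omega)$ with $\Phi'\le1$ on $(0,u^*)$, $\Phi'(u^*)=1$ and $\Phi'\ge1$ on $(u^*,\omega)$. (A.1b)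 $\Phi$ is extended to negative arguments, and $$b(s)=\begin{cases}s,& s\le u^*\\ \Phi^{-1}(\Phi(u^*)+s-u^*),& s\ge u^*,\end{cases}\qquad B(s)=\begin{cases}\Phi(s),& s\le u^*\\ \Phi(u^*)+s-u^*,& s\ge u^*\end{cases}$$ (where $\Phi^{-1}(y)=\omega$ for $y\ge\Phi_{\rm M}$). The extension is such that $b,B\in C^1(\mathbb R)$, $B=\Phi\circ b$, $b(0)=B(0)=0$, $0\le b',B'\le1$ and $b'+B'\ge1$ on $\mathbb R$. Moreover $b'$ and $B'$ are Lipschitz continuous. (A.2) There is $L_F>0$ with $|F(u)-F(v)|^2\le L_F|u-v||\Phi(u)-\Phi(v)|$ for all $u,v<\omega$, where $F:[0,\omega)\to\mathbb R^d$ is also extended to negative arguments (for instance by the constant $F(0)$), and to $u=\omega$ by its limit if $\omega<\infty$ and $\Phi_{\rm M}<\infty$. *Problems.* Let $f\in H^{-1}(\Omega)$, $u_{n-1}\in L^2(\Omega)$ and $\tau>0$. Let $(s_n,u_n,w_n)\in\mathcal Z$ be a weak solution of the time-discrete problem, i.e. for all $(\psi,\phi,\varphi)\in\mathcal Z$, $$\left(\tfrac1\tau(u_n-u_{n-1}),\varphi\right)+(\nabla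 w_n,\nabla\varphi)=(F(b(s_n)),\nabla\varphi)+\langle f,\varphi\rangle,\quad (u_n,\phi)=(b(s_n),\phi),\quad (w_n,\psi)=(B(s_n),\psi).$$ Assume that $u_n\ge0$ a.e. in $\Omega$, or that the extension of $\Phi$ is strictly increasing on $(-\infty,0)$. Let $M\in\mathbb R$ and $\epsilon>0$, let $s_n^0\in L^2(\Omega)$, and let $(s_n^i,u_n^i,w_n^i)\in\mathcal Z$, $i\ge1$, satisfy for all $(\psi,\phi,\varphi)\in\mathcal Z$ $$\left(\tfrac1\tau(u_n^i-u_{n-1}),\varphi\right)+(\nabla w_n^i,\nabla\varphi)=(F(b(s_n^{i-1})),\nabla\varphi)+\langle f,\varphi\rangle,$$ $$(u_n^i-b(s_n^{i-1}),\phi)=(L_b^i(s_n^i-s_n^{i-1}),\phi),\qquad (w_n^i-B(s_n^{i-1}),\psi)=(L_B^i(s_n^i-s_n^{i-1}),\psi),$$ with the M-scheme coefficients $$L_\rho^i=\min\{\max(\rho'(s_n^{i-1})+M\tau,\,2M\tau),\,1+\epsilon\},\qquad \rho\in\{b,B\}.$$ *Parameters.* Assume that for some $\Lambda>0$ one has $\|s_n^i-s_n\|_{L^\infty(\Omega)}\le\Lambda\tau$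 for all $i\ge0$. Put $M_0=\Lambda\max\{[b']_{\rm Lip},[B']_{\rm Lip}\}$ and assume $M>M_0+L_F$, $0<\tau<\min\{1/(M+M_0),1/L_F\}$ and $0<\epsilon<(M-M_0-L_F)\tau$. *Conclusions.* 1. As $i\to\infty$, $\|s_n^i-s_n\|_{L^1(\Omega)}+\|u_n^i-u_n\|_{L^1(\Omega)}+\|w_n^i-w_n\|_{H^1(\Omega)}\to0$. 2. (Single-degenerate case.) There are constants $\Theta,\varrho>0$ depending only on $\Omega$ and $M$ (in particular not on $\tau$) such that, if $\ell_B:=\inf_{\mathbb R}B'>0$, then for all $i\ge1$ $$\|s_n^i-s_n\|^2+\varrho\|\nabla(w_n^i-w_n)\|^2+4M\epsilon\varrho\|s_n^i-s_n^{i-1}\|^2\le(1-\ell_B^2\Theta)\|s_n^{i-1}-s_n\|^2 .$$ 3. (Non-degenerate case.) If $\ell:=\min\{\inf_{\mathbb R}b',\inf_{\mathbb R}B'\}>0$, then for all $i\ge1$ $$\ell\|s_n^i-s_n\|^2+\tfrac\tau2\|\nabla(w_n^i-w_n)\|^2+\epsilon M\tau\|s_n^i-s_n^{i-1}\|^2\le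 M\tau\|s_n^{i-1}-s_n\|^2 .$$ -/

import Mathlib

open MeasureTheory Filter Topology
open scoped NNReal ENNReal

noncomputable section

namespace DoubleSplitting

/-! ## Function spaces on an open set `Ω ⊆ ℝᵈ` -/

/-- `L²(Ω)`. -/
abbrev L2 {d : ℕ} (Ω : Set (EuclideanSpace ℝ (Fin d))) : Type :=
  Lp ℝ 2 (volume.restrict Ω)

/-- `L²(Ω; ℝᵈ)`. -/
abbrev L2Vec {d : ℕ} (Ω : Set (EuclideanSpace ℝ (Fin d))) : Type :=
  Lp (EuclideanSpace ℝ (Fin d)) 2 (volume.restrict Ω)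

/-- The pairs `(φ, ∇φ)` with `φ ∈ C_c^∞(Ω)`, as elements of `L²(Ω) × L²(Ω; ℝᵈ)`. -/
def testPairs {d : ℕ} (Ω : Set (EuclideanSpace ℝ (Fin d))) : Set (L2 Ω × L2Vec Ω) :=
  {p | ∃ φ : EuclideanSpace ℝ (Fin d) → ℝ,
    ContDiff ℝ (⊤ : ℕ∞) φ ∧ HasCompactSupport φ ∧ tsupport φ ⊆ Ω ∧
      (p.1 : EuclideanSpace ℝ (Fin d) → ℝ) =ᵐ[volume.restrict Ω] φ ∧
      (p.2 : EuclideanSpace ℝ (Fin d) → EuclideanSpace ℝ (Fin d))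
        =ᵐ[volume.restrict Ω] gradient φ}

/-- `H¹₀(Ω)`, the closure of `C_c^∞(Ω)` in the `H¹` topology. A function `w` is stored together
with its weak gradient, as the pair `(w, ∇w)`; the product topology of `L²(Ω) × L²(Ω; ℝᵈ)` is the
topology of the `H¹` norm. -/
def H10 {d : ℕ} (Ω : Set (EuclideanSpace ℝ (Fin d))) : Submodule ℝ (L2 Ω × L2Vec Ω) :=
  (Submodule.span ℝ (testPairs Ω)).topologicalClosure

/-- The function underlying an element of `H¹₀(Ω)`. -/
def H10.fn {d : ℕ} {Ω : Set (EuclideanSpace ℝ (Fin d))} (w : H10 Ω) : L2 Ω := w.1.1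

/-- The weak gradient of an element of `H¹₀(Ω)`. -/
def H10.grad {d : ℕ} {Ω : Set (EuclideanSpace ℝ (Fin d))} (w : H10 Ω) : L2Vec Ω := w.1.2

/-- The `H¹(Ω)` norm. -/
def H10.h1Norm {d : ℕ} {Ω : Set (EuclideanSpace ℝ (Fin d))} (w : H10 Ω) : ℝ :=
  Real.sqrt (‖H10.fn w‖ ^ 2 + ‖H10.grad w‖ ^ 2)

/-- `H⁻¹(Ω)`, the dual of `H¹₀(Ω)`. -/
abbrev HMinusOne {d : ℕ} (Ω : Set (EuclideanSpace ℝ (Fin d))) : Type := H10 Ω →L[ℝ] ℝ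

/-! ## The nonlinearities

`Φ` and `F` are total functions on `ℝ`: for negative arguments they stand for an extension of the
given functions, for arguments above `umax` their values are irrelevant. At `u = umax < ∞` the map `Φ`
is, when bounded, the multivalued extension with value `[Φ_M, ∞)`. -/

/-- The structural assumptions on `Φ : [0, umax) → [0, ∞)`. (Almost everywhere differentiability is a
consequence of local Lipschitz continuity, and the limit `Φ_M` exists by monotonicity.) -/
structure DiffusionAssumption (umax : EReal) (Φ : ℝ → ℝ) : Prop where
  omega_eq : umax = 1 ∨ umax = ⊤
  map_zero : Φ 0 = 0
  nonneg : ∀ u : ℝ, 0 ≤ u → (u : EReal) < umax → 0 ≤ Φ u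
  locallyLipschitz : LocallyLipschitzOn {u : ℝ | 0 ≤ u ∧ (u : EReal) < umax} Φ
  strictMono : StrictMonoOn Φ {u : ℝ | 0 < u ∧ (u : EReal) < umax}
  at_zero : (∃ c : ℝ, 0 < c ∧ HasDerivWithinAt Φ c (Set.Ici 0) 0) ∨
    ∃ δ : ℝ, 0 < δ ∧ (δ : EReal) < umax ∧ ConvexOn ℝ (Set.Icc 0 δ) Φ

/-- `w ∈ Φ(u)`, where a bounded `Φ` is extended at `u = umax` by `[Φ_M, ∞)`, `Φ_M = sup Φ`. -/
def InGraph (umax : EReal) (Φ : ℝ → ℝ) (u w : ℝ) : Prop :=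
  ((u : EReal) < umax ∧ w = Φ u) ∨ ((u : EReal) = umax ∧ ∀ v : ℝ, (v : EReal) < umax → Φ v ≤ w)

/-- `b` and `B` decompose `Φ`: they are `C¹`, vanish at `0`, `B = Φ ∘ b`, `0 ≤ b', B' ≤ 1` and
`b' + B' ≥ 1`. -/
structure IsDecomposition (umax : EReal) (Φ b B : ℝ → ℝ) : Prop where
  contDiff_b : ContDiff ℝ 1 b
  contDiff_B : ContDiff ℝ 1 B
  b_zero : b 0 = 0
  B_zero : B 0 = 0
  comp : ∀ s : ℝ, InGraph umax Φ (b s) (B s)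
  deriv_b_mem : ∀ s : ℝ, deriv b s ∈ Set.Icc (0 : ℝ) 1
  deriv_B_mem : ∀ s : ℝ, deriv B s ∈ Set.Icc (0 : ℝ) 1
  one_le_add : ∀ s : ℝ, 1 ≤ deriv b s + deriv B s

/-- The extra regularity of `Φ`: `Φ'` is locally Lipschitz on `(0, umax)`, at most `1` below
`ustar ∈ (0, umax)`, equal to `1` at `ustar`, and at least `1` above. -/
structure RegularityAssumption (umax : EReal) (Φ : ℝ → ℝ) (ustar : ℝ) : Prop where
  differentiable : ∀ u : ℝ, 0 < u → (u : EReal) < umax → DifferentiableAt ℝ Φ u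
  locallyLipschitz : LocallyLipschitzOn {u : ℝ | 0 < u ∧ (u : EReal) < umax} (deriv Φ)
  ustar_pos : 0 < ustar
  ustar_lt : (ustar : EReal) < umax
  deriv_le : ∀ u : ℝ, 0 < u → u < ustar → deriv Φ u ≤ 1
  deriv_eq : deriv Φ ustar = 1
  le_deriv : ∀ u : ℝ, ustar < u → (u : EReal) < umax → 1 ≤ deriv Φ u

/-- The inverse of the (multivalued) graph `Φ`, for values `y ≥ 0`; it equals `umax` for
`y ≥ Φ_M` when `Φ_M < ∞`. -/
def graphInv (umax : EReal) (Φ : ℝ → ℝ) (y : ℝ) : ℝ :=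
  sSup {u : ℝ | (u : EReal) < umax ∧ Φ u ≤ y}

/-- `b(s) = s` for `s ≤ ustar`, and `b(s) = Φ⁻¹(Φ(ustar) + s - ustar)` for `s ≥ ustar`. -/
def bFun (umax : EReal) (Φ : ℝ → ℝ) (ustar s : ℝ) : ℝ :=
  if s ≤ ustar then s else graphInv umax Φ (Φ ustar + s - ustar)

/-- `B(s) = Φ(s)` for `s ≤ ustar`, and `B(s) = Φ(ustar) + s - ustar` for `s ≥ ustar`. -/
def BFun (Φ : ℝ → ℝ) (ustar s : ℝ) : ℝ :=
  if s ≤ ustar then Φ s else Φ ustar + s - ustar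

/-- The growth condition on the flux `F`, with constant `LF`. The last field gives `F(umax)` its only
meaning, the limit, in the case `umax < ∞`, `Φ_M < ∞`, where the value `u = umax` is attained. -/
structure FluxAssumption {d : ℕ} (umax : EReal) (Φ : ℝ → ℝ) (F : ℝ → EuclideanSpace ℝ (Fin d))
    (LF : ℝ) : Prop where
  pos : 0 < LF
  bound : ∀ u v : ℝ, (u : EReal) < umax → (v : EReal) < umax →
    ‖F u - F v‖ ^ 2 ≤ LF * |u - v| * |Φ u - Φ v|
  at_omega : ∀ c : ℝ, (c : EReal) = umax → BddAbove (Φ '' Set.Iio c) →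
    Tendsto F (𝓝[<] c) (𝓝 (F c))

/-- The best Lipschitz constant of a Lipschitz function on `ℝ`. -/
def lipConst (g : ℝ → ℝ) : ℝ :=
  sInf {K : ℝ | 0 ≤ K ∧ ∀ x y : ℝ, |g x - g y| ≤ K * |x - y|}

/-! ## The time-discrete problem and its linearization -/

/-- `(s, u, w) ∈ L²(Ω) × L²(Ω) × H¹₀(Ω)` is a weak solution of
`(u - uPrev) / τ + div F(u) = Δ w + f`, `u = b(s)`, `w = B(s)`. -/
structure IsWeakSolution {d : ℕ} (Ω : Set (EuclideanSpace ℝ (Fin d)))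
    (F : ℝ → EuclideanSpace ℝ (Fin d)) (b B : ℝ → ℝ) (τ : ℝ) (f : HMinusOne Ω)
    (uPrev s u : L2 Ω) (w : H10 Ω) : Prop where
  balance : ∀ φ : H10 Ω,
    (∫ x in Ω, (1 / τ) * (u x - uPrev x) * H10.fn φ x)
        + (∫ x in Ω, inner ℝ (H10.grad w x) (H10.grad φ x))
      = (∫ x in Ω, inner ℝ (F (b (s x))) (H10.grad φ x)) + f φ
  u_eq : ∀ φ : L2 Ω, ∫ x in Ω, u x * φ x = ∫ x in Ω, b (s x) * φ x
  w_eq : ∀ ψ : L2 Ω, ∫ x in Ω, H10.fn w x * ψ x = ∫ x in Ω, B (s x) * ψ x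

/-- One step `sOld ↦ (s, u, w)` of the double-splitting linearization, in weak form, with
coefficient functions `Lb` and `LB` evaluated at the previous iterate. -/
structure IsLinearizedStep {d : ℕ} (Ω : Set (EuclideanSpace ℝ (Fin d)))
    (F : ℝ → EuclideanSpace ℝ (Fin d)) (b B : ℝ → ℝ) (Lb LB : ℝ → ℝ) (τ : ℝ) (f : HMinusOne Ω)
    (uPrev sOld s u : L2 Ω) (w : H10 Ω) : Prop where
  balance : ∀ φ : H10 Ω,
    (∫ x in Ω, (1 / τ) * (u x - uPrev x) * H10.fn φ x)
        + (∫ x in Ω, inner ℝ (H10.grad w x) (H10.grad φ x))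
      = (∫ x in Ω, inner ℝ (F (b (sOld x))) (H10.grad φ x)) + f φ
  u_eq : ∀ φ : L2 Ω,
    ∫ x in Ω, (u x - b (sOld x)) * φ x = ∫ x in Ω, Lb (sOld x) * (s x - sOld x) * φ x
  w_eq : ∀ ψ : L2 Ω,
    ∫ x in Ω, (H10.fn w x - B (sOld x)) * ψ x = ∫ x in Ω, LB (sOld x) * (s x - sOld x) * ψ x

/-- The coefficient of the M-scheme, `min (max (ρ' + Mτ, 2Mτ), 1 + ε)` for `ρ ∈ {b, B}`. -/
def mFactor (M τ ε : ℝ) (ρ : ℝ → ℝ) (t : ℝ) : ℝ :=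
  min (max (deriv ρ t + M * τ) (2 * M * τ)) (1 + ε)

end DoubleSplitting

end

open DoubleSplitting

namespace DoubleSplitting

/-! ## Difference quotients -/

/-! At almost every point let `a`, `s`, `c` be the values of the old iterate, the new iterate and
the exact solution, and let β, γ be the difference quotients of `b`, `B` between `a` and `c`. The
errors in u and w are affine in `a - c` and `s - a`, so polarization writes their product as a
combination of `(s - c)^2`, `(a - c)^2` and `(s - a)^2`. Because one of `b'`, `B'` equals 1 at every
point, one of the two M-scheme coefficients is always `1 + ε`. The other overestimates its
difference quotient, since closeness of the iterates keeps quotients within `M₀ * τ / 2` of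
derivatives. This gives `coeff_bounds` and `pairing_lower`.

Testing the difference of the balance equations with the error in w (`energy_le`) bounds the
integral of that product plus the gradient energy by a flux term, which the pointwise bound absorbs.
Hence the L² error in s never increases, and its decrease controls increments and gradients
(`error_decay`).

In the doubly degenerate case the increments and gradients therefore tend to zero. Poincaré gives
`B(sᵢ) → B(s)` in L², and the balance equation with density of H¹₀ gives weak convergence of u, in
particular convergence of the mean of `b(sᵢ) - b(s)`. Strict increase of `B` to the right kills the
positive part of this difference (`tendsto_integral_posPart`), and the vanishing mean then kills the
negative part. L¹ convergence of s follows from `|s - t| ≤ |b s - b t| + |B s - B t|`.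

If `B'` is bounded below, there is a pointwise gain where `b' = 1`; where `B' = 1` the gain comes
from the w error, paid for by Poincaré and part of the gradient term (`pairing_lower_single`). If
both derivatives are at least ℓ, then `βγ ≥ β + γ - 1 ≥ ℓ` suffices (`pairing_lower_nondegenerate`).
-/

theorem dslope_mul_sub (g : ℝ → ℝ) (a c : ℝ) : g a - g c = dslope g a c * (a - c) := by
  have h := sub_smul_dslope g a c
  rw [smul_eq_mul] at h
  linarith

theorem le_dslope_of_le_deriv {g : ℝ → ℝ} (hg : Differentiable ℝ g) {m : ℝ}
    (h : ∀ t, m ≤ deriv g t) (a c : ℝ) : m ≤ dslope g a c := by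
  rcases eq_or_ne c a with rfl | hne
  · rw [dslope_same]; exact h _
  · have e := dslope_mul_sub g a c
    rcases lt_or_gt_of_ne hne with hlt | hlt
    · have := mul_sub_le_image_sub_of_le_deriv hg h hlt.le
      rw [e] at this
      exact le_of_mul_le_mul_right this (sub_pos.2 hlt)
    · have := mul_sub_le_image_sub_of_le_deriv hg h hlt.le
      have e' : g c - g a = dslope g a c * (c - a) := by linarith
      rw [e'] at this
      exact le_of_mul_le_mul_right this (sub_pos.2 hlt)

theorem dslope_le_of_deriv_le {g : ℝ → ℝ} (hg : Differentiable ℝ g) {m : ℝ}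
    (h : ∀ t, deriv g t ≤ m) (a c : ℝ) : dslope g a c ≤ m := by
  have h1 := le_dslope_of_le_deriv (g := fun t => -g t) hg.neg (m := -m)
    (fun t => by rw [deriv.fun_neg]; exact neg_le_neg (h t)) a c
  rcases eq_or_ne c a with rfl | hne
  · rw [dslope_same]; exact h _
  · rw [dslope_of_ne _ hne] at h1 ⊢
    rw [show slope (fun t => -g t) a c = -slope g a c by
      simp only [slope_def_field]; ring] at h1
    linarith

/-- A linear combination of difference quotients is bounded below like the derivatives. -/
theorem le_dslope_add_mul_dslope {g h : ℝ → ℝ} (hg : Differentiable ℝ g)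
    (hh : Differentiable ℝ h) {k m : ℝ} (H : ∀ t, m ≤ deriv g t + k * deriv h t) (a c : ℝ) :
    m ≤ dslope g a c + k * dslope h a c := by
  have hd : Differentiable ℝ (fun t => g t + k * h t) := hg.add (hh.const_mul k)
  have hderiv : ∀ t, deriv (fun t => g t + k * h t) t = deriv g t + k * deriv h t := fun t =>
    ((hg t).hasDerivAt.add ((hh t).hasDerivAt.const_mul k)).deriv
  have h1 := le_dslope_of_le_deriv hd (fun t => (hderiv t).symm ▸ H t) a c
  rcases eq_or_ne c a with rfl | hne
  · rw [dslope_same, dslope_same]; exact H _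
  · rw [dslope_of_ne _ hne] at h1 ⊢
    rw [dslope_of_ne _ hne]
    rw [show slope (fun t => g t + k * h t) a c = slope g a c + k * slope h a c by
      simp only [slope_def_field]; ring] at h1
    exact h1

/-- First-order Taylor remainder along the segment from `a` to `c`. The factor 1/2, which a bare
mean value argument would lose, makes the two deviations of β and γ add up to `M₀ * τ` in
`coeff_bounds`. -/
theorem abs_dslope_sub_deriv_le {g : ℝ → ℝ} (hg : Differentiable ℝ g) {K : ℝ}
    (hK : ∀ s t, |deriv g s - deriv g t| ≤ K * |s - t|) (a c : ℝ) :
    |dslope g a c - deriv g a| ≤ K * |a - c| / 2 := by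
  rcases eq_or_ne c a with rfl | hne
  · simp [dslope_same]
  set x : ℝ := c - a with hx
  have hx0 : x ≠ 0 := sub_ne_zero.2 hne
  have hder : ∀ t : ℝ, HasDerivAt (fun t => g (a + t * x) - g a - deriv g a * (t * x))
      (deriv g (a + t * x) * x - deriv g a * x) t := by
    intro t
    have h1 : HasDerivAt (fun t : ℝ => a + t * x) x t := by
      simpa using ((hasDerivAt_id t).mul_const x).const_add a
    have h2 : HasDerivAt (fun t : ℝ => deriv g a * (t * x)) (deriv g a * x) t := by
      simpa using ((hasDerivAt_id t).mul_const x).const_mul (deriv g a)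
    have h3 : HasDerivAt (fun t : ℝ => g (a + t * x)) (deriv g (a + t * x) * x) t :=
      (hg (a + t * x)).hasDerivAt.comp t h1
    exact (h3.sub_const (g a)).sub h2
  have hB : ∀ t : ℝ, HasDerivAt (fun t => K * x ^ 2 * t ^ 2 / 2) (K * x ^ 2 * t) t := by
    intro t
    have := ((hasDerivAt_pow 2 t).const_mul (K * x ^ 2)).div_const 2
    refine this.congr_deriv ?_
    push_cast
    ring
  have key := image_norm_le_of_norm_deriv_right_le_deriv_boundary
    (f := fun t => g (a + t * x) - g a - deriv g a * (t * x)) (a := 0) (b := 1)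
    (f' := fun t => deriv g (a + t * x) * x - deriv g a * x)
    (B := fun t => K * x ^ 2 * t ^ 2 / 2) (B' := fun t => K * x ^ 2 * t)
    (fun t _ => (hder t).continuousAt.continuousWithinAt)
    (fun t _ => (hder t).hasDerivWithinAt) (by simp) hB
    (fun t ht => by
      rw [Real.norm_eq_abs, ← sub_mul, abs_mul]
      have h1 := hK (a + t * x) a
      rw [add_sub_cancel_left, abs_mul, abs_of_nonneg ht.1] at h1
      calc _ ≤ K * (t * |x|) * |x| := mul_le_mul_of_nonneg_right h1 (abs_nonneg _)
        _ = K * x ^ 2 * t := by rw [← sq_abs x]; ring)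
    (Set.right_mem_Icc.2 zero_le_one)
  have e : g (a + 1 * x) - g a - deriv g a * (1 * x) = (dslope g a c - deriv g a) * x := by
    have := dslope_mul_sub g a c
    rw [show a + 1 * x = c by rw [hx]; ring]
    rw [hx]; linarith
  simp only [Real.norm_eq_abs] at key
  rw [e, abs_mul, ← sq_abs x] at key
  have hpos : 0 < |x| := abs_pos.2 hx0
  rw [abs_sub_comm a c, ← hx]
  refine le_of_mul_le_mul_right ?_ hpos
  linarith

theorem abs_sub_le_lipConst {g : ℝ → ℝ} (hg : ∃ K : ℝ≥0, LipschitzWith K g) (s t : ℝ) :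
    |g s - g t| ≤ lipConst g * |s - t| := by
  rcases eq_or_ne s t with rfl | hne
  · simp
  have hpos : 0 < |s - t| := abs_pos.2 (sub_ne_zero.2 hne)
  rw [← div_le_iff₀ hpos]
  obtain ⟨K, hK⟩ := hg
  refine le_csInf ⟨K, K.2, fun x y => ?_⟩ fun L hL => (div_le_iff₀ hpos).2 (hL.2 s t)
  simpa [Real.dist_eq] using hK.dist_le_mul x y

theorem lipConst_nonneg (g : ℝ → ℝ) : 0 ≤ lipConst g :=
  Real.sInf_nonneg fun _ h => h.1

/-! ## Parameters and nonlinearities -/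

/-- The constraints relating the parameters of the M-scheme. -/
structure MParams (M M₀ LF τ ε : ℝ) : Prop where
  M₀_nonneg : 0 ≤ M₀
  LF_pos : 0 < LF
  lt_M : M₀ + LF < M
  τ_pos : 0 < τ
  add_mul_lt : (M + M₀) * τ < 1
  LF_mul_lt : LF * τ < 1
  ε_pos : 0 < ε
  ε_lt : ε < (M - M₀ - LF) * τ

/-- The properties of the pair `b`, `B` on which the convergence analysis relies. -/
structure SplitPair (b B : ℝ → ℝ) : Prop where
  contDiff_b : ContDiff ℝ 1 b
  contDiff_B : ContDiff ℝ 1 B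
  deriv_b_mem : ∀ s : ℝ, deriv b s ∈ Set.Icc (0 : ℝ) 1
  deriv_B_mem : ∀ s : ℝ, deriv B s ∈ Set.Icc (0 : ℝ) 1
  deriv_eq_one : ∀ s : ℝ, deriv b s = 1 ∨ deriv B s = 1

theorem SplitPair.symm {b B : ℝ → ℝ} (h : SplitPair b B) : SplitPair B b :=
  ⟨h.contDiff_B, h.contDiff_b, h.deriv_B_mem, h.deriv_b_mem,
    fun s => (h.deriv_eq_one s).symm⟩

theorem SplitPair.diff_b {b B : ℝ → ℝ} (h : SplitPair b B) : Differentiable ℝ b :=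
  h.contDiff_b.differentiable one_ne_zero

theorem SplitPair.diff_B {b B : ℝ → ℝ} (h : SplitPair b B) : Differentiable ℝ B :=
  h.contDiff_B.differentiable one_ne_zero

theorem SplitPair.monotone_b {b B : ℝ → ℝ} (h : SplitPair b B) : Monotone b :=
  monotone_of_deriv_nonneg h.diff_b fun s => (h.deriv_b_mem s).1

theorem SplitPair.monotone_B {b B : ℝ → ℝ} (h : SplitPair b B) : Monotone B :=
  h.symm.monotone_b

theorem SplitPair.dslope_mem {b B : ℝ → ℝ} (h : SplitPair b B) (a c : ℝ) :
    dslope b a c ∈ Set.Icc (0 : ℝ) 1 :=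
  ⟨le_dslope_of_le_deriv h.diff_b (fun t => (h.deriv_b_mem t).1) a c,
    dslope_le_of_deriv_le h.diff_b (fun t => (h.deriv_b_mem t).2) a c⟩

theorem SplitPair.one_le_dslope_add {b B : ℝ → ℝ} (h : SplitPair b B) (a c : ℝ) :
    1 ≤ dslope b a c + dslope B a c := by
  have := le_dslope_add_mul_dslope h.diff_b h.diff_B (k := 1) (m := 1) (fun t => by
    have h1 := (h.deriv_b_mem t).1
    have h2 := (h.deriv_B_mem t).1
    rcases h.deriv_eq_one t with h3 | h3 <;> linarith) a c
  linarith

theorem SplitPair.abs_sub_le {b B : ℝ → ℝ} (h : SplitPair b B) (a c : ℝ) :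
    |b a - b c| ≤ |a - c| := by
  rw [dslope_mul_sub, abs_mul, abs_of_nonneg (h.dslope_mem a c).1]
  exact mul_le_of_le_one_left (abs_nonneg _) (h.dslope_mem a c).2

theorem SplitPair.abs_sub_le_add {b B : ℝ → ℝ} (h : SplitPair b B) (a c : ℝ) :
    |a - c| ≤ |b a - b c| + |B a - B c| := by
  rw [dslope_mul_sub b, dslope_mul_sub B, abs_mul, abs_mul, abs_of_nonneg (h.dslope_mem a c).1,
    abs_of_nonneg (h.symm.dslope_mem a c).1, ← add_mul]
  exact le_mul_of_one_le_left (abs_nonneg _) (h.one_le_dslope_add a c)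

/-! ## The M-scheme coefficients -/

theorem mFactor_of_deriv_eq_one {M M₀ LF τ ε : ℝ} (P : MParams M M₀ LF τ ε) {b : ℝ → ℝ} {a : ℝ}
    (h : deriv b a = 1) : mFactor M τ ε b a = 1 + ε := by
  obtain ⟨h1, h2, h3, h4, h5, h6, h7, h8⟩ := P
  have : 0 ≤ (M₀ + LF) * τ := by positivity
  rw [mFactor, h]
  exact min_eq_right (le_max_of_le_left (by nlinarith))

/-- Half the smallest possible value of an M-scheme coefficient. -/
noncomputable def mFloor (M τ ε : ℝ) : ℝ := min (2 * M * τ) (1 + ε) / 2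

theorem two_mul_mFloor_le_mFactor (M τ ε : ℝ) (b : ℝ → ℝ) (a : ℝ) :
    2 * mFloor M τ ε ≤ mFactor M τ ε b a := by
  rw [mFloor, mul_div_cancel₀ _ two_ne_zero, mFactor]
  exact min_le_min_right _ (le_max_right _ _)

theorem MParams.M_pos {M M₀ LF τ ε : ℝ} (P : MParams M M₀ LF τ ε) : 0 < M := by
  have := P.1; have := P.2; have := P.3; linarith

theorem mFloor_pos {M M₀ LF τ ε : ℝ} (P : MParams M M₀ LF τ ε) : 0 < mFloor M τ ε := by
  have := P.M_pos; have := P.τ_pos; have := P.ε_pos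
  unfold mFloor
  positivity

theorem mFloor_le {M τ ε : ℝ} : mFloor M τ ε ≤ M * τ := by
  have := min_le_left (2 * M * τ) (1 + ε)
  unfold mFloor
  linarith

/-- Bounds for the quadratic form `(βx + (1 + ε)(y - x)) (γx + L(y - x))` at points where the
first nonlinearity has slope one. -/
theorem coeff_bounds {M M₀ LF τ ε β γ g L : ℝ} (P : MParams M M₀ LF τ ε)
    (hβ : β ∈ Set.Icc (0 : ℝ) 1) (hγ : γ ∈ Set.Icc (0 : ℝ) 1)
    (hβ1 : |β - 1| ≤ M₀ * τ / 2) (hγg : |γ - g| ≤ M₀ * τ / 2)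
    (hL : L = min (max (g + M * τ) (2 * M * τ)) (1 + ε)) :
    mFloor M τ ε * (β + γ) ≤ ((1 + ε) * γ + L * β) / 2 ∧
    β * γ ≤ ((1 + ε) * γ + L * β) / 2 ∧
    ((1 + ε) * γ + L * β) / 2 - β * γ + τ * LF / 2 * (β * γ) ≤ mFloor M τ ε ∧
    ε * M * τ ≤ ((1 + ε) * (L - γ) + (1 + ε - β) * L) / 2 := by
  have hM := P.M_pos
  obtain ⟨h1, h2, h3, h4, h5, h6, h7, h8⟩ := P
  obtain ⟨hβ0, hβ2⟩ := hβ
  obtain ⟨hγ0, hγ2⟩ := hγ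
  rw [abs_le] at hβ1 hγg
  have hMτ : 0 < M * τ := by positivity
  have hM₀τ : 0 ≤ M₀ * τ := by positivity
  have hLτ : 0 < LF * τ := by positivity
  have h8' : ε < M * τ - M₀ * τ - LF * τ := by linarith
  have h5' : M * τ + M₀ * τ < 1 := by linarith
  have hN1 : mFloor M τ ε * 2 ≤ 1 + ε := by
    rw [mFloor, div_mul_cancel₀ _ two_ne_zero]; exact min_le_right _ _
  have hN2 : mFloor M τ ε * 2 ≤ L := by
    rw [mFloor, div_mul_cancel₀ _ two_ne_zero, hL]
    exact min_le_min_right _ (le_max_right _ _)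
  have hLle : L ≤ 1 + ε := hL ▸ min_le_right _ _
  -- The coefficient dominates the difference quotient: the shift `M * τ` exceeds the deviation `M₀
  -- * τ / 2`, and the cap `1 + ε` exceeds any quotient.
  have hq : γ ≤ L := by
    rw [hL]
    exact le_min (le_max_of_le_left (by linarith)) (by linarith)
  have hβγ0 : 0 ≤ β * γ := mul_nonneg hβ0 hγ0
  have hprod : 0 ≤ (1 - β) * (1 - γ) := mul_nonneg (by linarith) (by linarith)
  have hβγ1 : β * γ ≤ 1 := mul_le_one₀ hβ2 hγ0 hγ2
  refine ⟨?_, ?_, ?_, ?_⟩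
  · nlinarith [mul_le_mul_of_nonneg_right hN1 hγ0, mul_le_mul_of_nonneg_right hN2 hβ0]
  · nlinarith [mul_le_mul_of_nonneg_right hq hβ0,
      mul_le_mul_of_nonneg_right (show β ≤ 1 + ε by linarith) hγ0]
  · have hq1 : β * (L - γ) ≤ L - γ := mul_le_of_le_one_left (by linarith) hβ2
    have hp1 : γ * (1 + ε - β) ≤ 1 + ε - β := mul_le_of_le_one_left (by linarith) hγ2
    -- The cases follow which term defines `mFloor`, and then which term of the maximum bounds `L`.
    rcases le_total (1 + ε) (2 * M * τ) with hc | hc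
    · have hN : mFloor M τ ε = (1 + ε) / 2 := by rw [mFloor, min_eq_right hc]
      have hL1 : L = 1 + ε := by
        rw [hL]; exact min_eq_right (le_max_of_le_right hc)
      rw [hN, hL1]
      have a1 := mul_nonneg (show (0 : ℝ) ≤ 1 + ε by linarith) hprod
      have a2 := mul_nonneg hβγ0 (show 0 ≤ 1 - ε - LF * τ by linarith)
      nlinarith
    · have hN : mFloor M τ ε = M * τ := by rw [mFloor, min_eq_left hc]; ring
      rw [hN]
      have hLmax : L ≤ max (g + M * τ) (2 * M * τ) := hL ▸ min_le_left _ _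
      rcases le_max_iff.1 hLmax with hl | hl
      -- Here `L - γ ≤ M * τ + M₀ * τ / 2` and `1 + ε - β ≤ ε + M₀ * τ / 2`; adding `LF * τ`, the
      -- claim becomes `ε + M₀ * τ + LF * τ ≤ M * τ`, the assumed bound on ε.
      · have a1 := mul_le_of_le_one_right hLτ.le hβγ1
        nlinarith
      · have a1 := mul_nonneg hγ0 (show 0 ≤ 1 - (1 + ε - β) - LF * τ by linarith)
        have a2 : LF * τ * (β * γ) ≤ LF * τ * γ :=
          mul_le_mul_of_nonneg_left (mul_le_of_le_one_left hγ0 hβ2) hLτ.le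
        nlinarith
  · rcases le_total (1 + ε) (2 * M * τ) with hc | hc
    · have hL1 : L = 1 + ε := by
        rw [hL]; exact min_eq_right (le_max_of_le_right hc)
      rw [hL1]
      nlinarith [mul_le_mul_of_nonneg_left (show M * τ ≤ 1 by linarith) h7.le]
    · have hL2 : 2 * M * τ ≤ L := hL ▸ le_min (le_max_right _ _) hc
      have a1 := mul_nonneg (show (0 : ℝ) ≤ 1 + ε by linarith) (sub_nonneg.2 hq)
      have a2 : ε * (2 * M * τ) ≤ (1 + ε - β) * L :=
        mul_le_mul (by linarith) hL2 (by positivity) (by linarith)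
      nlinarith

/-- Data for the comparison of `a` (old iterate) and `c` (exact solution). -/
structure CloseData (M₀ τ : ℝ) (b B : ℝ → ℝ) (a c : ℝ) : Prop where
  left : |dslope b a c - deriv b a| ≤ M₀ * τ / 2
  right : |dslope B a c - deriv B a| ≤ M₀ * τ / 2

theorem CloseData.symm {M₀ τ a c : ℝ} {b B : ℝ → ℝ} (h : CloseData M₀ τ b B a c) :
    CloseData M₀ τ B b a c := ⟨h.2, h.1⟩

theorem closeData_of_abs_sub_le {b B : ℝ → ℝ} (h : SplitPair b B)
    (hb : ∃ K : ℝ≥0, LipschitzWith K (deriv b)) (hB : ∃ K : ℝ≥0, LipschitzWith K (deriv B))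
    {Λ τ a c : ℝ} (hac : |a - c| ≤ Λ * τ) :
    CloseData (Λ * max (lipConst (deriv b)) (lipConst (deriv B))) τ b B a c := by
  have aux : ∀ K K' : ℝ, 0 ≤ K → K ≤ K' → K * |a - c| / 2 ≤ Λ * K' * τ / 2 := by
    intro K K' h0 h1
    have : K * |a - c| ≤ K' * (Λ * τ) := mul_le_mul h1 hac (abs_nonneg _) (h0.trans h1)
    linarith
  exact ⟨(abs_dslope_sub_deriv_le h.diff_b (abs_sub_le_lipConst hb) a c).trans
      (aux _ _ (lipConst_nonneg _) (le_max_left _ _)),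
    (abs_dslope_sub_deriv_le h.diff_B (abs_sub_le_lipConst hB) a c).trans
      (aux _ _ (lipConst_nonneg _) (le_max_right _ _))⟩

/-! ### Pointwise lower bounds for the product of the errors in u and w -/

section Pointwise

variable {M M₀ LF τ ε : ℝ} {b B : ℝ → ℝ} {a c : ℝ}

/-- With `x = a - c`, `y = s - c` and `A = ((1 + ε) * γ + L * β) / 2`, polarization gives the
product as `A * y^2 - (A - β * γ) * x^2 + ((1 + ε) * L - A) * (y - x)^2`. The four bounds of
`coeff_bounds` apply term by term. The two alternatives for `m` are the two available lower bounds
for `A`. -/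
theorem pairing_lower_of_deriv_eq_one (P : MParams M M₀ LF τ ε) (S : SplitPair b B)
    (C : CloseData M₀ τ b B a c) (h1 : deriv b a = 1) {m : ℝ}
    (hm : m ≤ mFloor M τ ε * (dslope b a c + dslope B a c) ∨ m ≤ dslope b a c * dslope B a c)
    (s : ℝ) :
    m * (s - c) ^ 2 - mFloor M τ ε * (a - c) ^ 2 + ε * M * τ * (s - a) ^ 2
        + τ * LF / 2 * ((b a - b c) * (B a - B c))
      ≤ (b a + mFactor M τ ε b a * (s - a) - b c) *
        (B a + mFactor M τ ε B a * (s - a) - B c) := by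
  obtain ⟨k1, k2, k3, k4⟩ := coeff_bounds P (S.dslope_mem a c) (S.symm.dslope_mem a c)
    (h1 ▸ C.left) C.right rfl
  rw [mFactor_of_deriv_eq_one P h1]
  have e1 := dslope_mul_sub b a c
  have e2 := dslope_mul_sub B a c
  rw [show min (max (deriv B a + M * τ) (2 * M * τ)) (1 + ε) = mFactor M τ ε B a from rfl]
    at k1 k2 k3 k4
  generalize mFactor M τ ε B a = L at *
  generalize dslope b a c = β at *
  generalize dslope B a c = γ at *
  generalize mFloor M τ ε = N at *
  have hm' : m ≤ ((1 + ε) * γ + L * β) / 2 := by rcases hm with h | h <;> linarith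
  have i1 := mul_le_mul_of_nonneg_right hm' (sq_nonneg (s - c))
  have i2 := mul_le_mul_of_nonneg_right k3 (sq_nonneg (a - c))
  have i3 := mul_le_mul_of_nonneg_right k4 (sq_nonneg (s - a))
  have e3 : b a + (1 + ε) * (s - a) - b c = β * (a - c) + (1 + ε) * (s - a) := by linarith
  have e4 : B a + L * (s - a) - B c = γ * (a - c) + L * (s - a) := by linarith
  rw [e3, e4, e1, e2]
  linarith

/-- The basic lower bound for the product of the errors in `u` and `w`. -/
theorem pairing_lower (P : MParams M M₀ LF τ ε) (S : SplitPair b B)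
    (C : CloseData M₀ τ b B a c) (s : ℝ) {m : ℝ}
    (hm : m ≤ mFloor M τ ε * (dslope b a c + dslope B a c) ∨ m ≤ dslope b a c * dslope B a c) :
    m * (s - c) ^ 2 - mFloor M τ ε * (a - c) ^ 2 + ε * M * τ * (s - a) ^ 2
        + τ * LF / 2 * ((b a - b c) * (B a - B c))
      ≤ (b a + mFactor M τ ε b a * (s - a) - b c) *
        (B a + mFactor M τ ε B a * (s - a) - B c) := by
  rcases S.deriv_eq_one a with h1 | h1
  · exact pairing_lower_of_deriv_eq_one P S C h1 hm s
  -- The estimate is symmetric under exchanging `b` and `B`.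
  · have := pairing_lower_of_deriv_eq_one P S.symm C.symm h1 (m := m)
      (by rwa [add_comm, mul_comm (dslope B a c)]) s
    rwa [mul_comm (B a - B c), mul_comm (B a + _ - B c)] at this

/-- From `β + γ ≥ 1` alone, the new and old errors carry the same weight: no contraction, but a
monotone quantity. -/
theorem pairing_lower_degenerate (P : MParams M M₀ LF τ ε) (S : SplitPair b B)
    (C : CloseData M₀ τ b B a c) (s : ℝ) :
    mFloor M τ ε * (s - c) ^ 2 - mFloor M τ ε * (a - c) ^ 2 + ε * M * τ * (s - a) ^ 2
        + τ * LF / 2 * ((b a - b c) * (B a - B c))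
      ≤ (b a + mFactor M τ ε b a * (s - a) - b c) *
        (B a + mFactor M τ ε B a * (s - a) - B c) :=
  pairing_lower P S C s (Or.inl (le_mul_of_one_le_right (mFloor_pos P).le
    (S.one_le_dslope_add a c)))

theorem pairing_lower_nondegenerate (P : MParams M M₀ LF τ ε) (S : SplitPair b B)
    (C : CloseData M₀ τ b B a c) {ℓ : ℝ} (hb : ∀ t, ℓ ≤ deriv b t) (hB : ∀ t, ℓ ≤ deriv B t)
    (s : ℝ) :
    ℓ * (s - c) ^ 2 - M * τ * (a - c) ^ 2 + ε * M * τ * (s - a) ^ 2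
        + τ * LF / 2 * ((b a - b c) * (B a - B c))
      ≤ (b a + mFactor M τ ε b a * (s - a) - b c) *
        (B a + mFactor M τ ε B a * (s - a) - B c) := by
  have h1 := le_dslope_add_mul_dslope S.diff_b S.diff_B (k := 1) (m := 1 + ℓ) (fun t => by
    rcases S.deriv_eq_one t with h | h
    · linarith [hB t]
    · linarith [hb t]) a c
  -- Expanding `(1 - β) * (1 - γ) ≥ 0` gives `β * γ ≥ β + γ - 1 ≥ ℓ`.
  have h2 := mul_nonneg (sub_nonneg.2 (S.dslope_mem a c).2) (sub_nonneg.2 (S.symm.dslope_mem a c).2)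
  have h3 := pairing_lower P S C s (m := ℓ) (Or.inr (by nlinarith))
  have h4 := mul_le_mul_of_nonneg_right (mFloor_le (M := M) (τ := τ) (ε := ε)) (sq_nonneg (a - c))
  linarith

/-- `M₀ < M` and `(M + M₀) * τ < 1` give `M₀ * τ < 1 / 2`, so the quotient deviates from 1 by at
most 1/4. -/
theorem three_quarters_le_dslope (P : MParams M M₀ LF τ ε) (C : CloseData M₀ τ b B a c)
    (h1 : deriv b a = 1) : 3 / 4 ≤ dslope b a c := by
  have h := (abs_le.1 C.left).1
  rw [h1] at h
  obtain ⟨p1, p2, p3, p4, p5, p6, p7, p8⟩ := P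
  nlinarith

/-- Where `B' = 1`, the error in `w` controls the error in `s`. -/
theorem sq_error_lower (P : MParams M M₀ LF τ ε) (S : SplitPair b B)
    (C : CloseData M₀ τ b B a c) (h1 : deriv B a = 1) (s : ℝ) :
    ((s - c) ^ 2 - (a - c) ^ 2) / 4 + (a - c) ^ 2 / 10
      ≤ (B a + mFactor M τ ε B a * (s - a) - B c) ^ 2 := by
  have hγ := three_quarters_le_dslope P C.symm h1
  have hγ1 := (S.symm.dslope_mem a c).2
  rw [mFactor_of_deriv_eq_one P h1]
  have e2 := dslope_mul_sub B a c
  have hε1 : ε < 1 := by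
    have := P.M_pos
    obtain ⟨p1, p2, p3, p4, p5, p6, p7, p8⟩ := P
    have : 0 ≤ (M₀ + LF) * τ := by positivity
    nlinarith
  have hε := P.ε_pos
  generalize dslope B a c = γ at *
  set x := a - c
  set y := s - c with hy
  have e : B a + (1 + ε) * (s - a) - B c = (1 + ε) * (y - (1 - γ / (1 + ε)) * x) := by
    have : B a - B c + (1 + ε) * (s - a) = γ * x + (1 + ε) * (y - x) := by
      rw [e2]; simp only [x, y]; ring
    rw [show B a + (1 + ε) * (s - a) - B c = B a - B c + (1 + ε) * (s - a) by ring, this]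
    field_simp
    ring
  have hr1 : 1 - γ / (1 + ε) ≤ 5 / 8 := by
    have : 3 / 8 ≤ γ / (1 + ε) := by rw [le_div_iff₀ (by linarith)]; linarith
    linarith
  have hr0 : 0 ≤ 1 - γ / (1 + ε) := by
    rw [sub_nonneg, div_le_one (by linarith)]; linarith
  rw [e]
  generalize 1 - γ / (1 + ε) = r at *
  have hr2 : r ^ 2 ≤ 25 / 64 := by nlinarith
  have h3 : (y - r * x) ^ 2 ≤ ((1 + ε) * (y - r * x)) ^ 2 := by
    rw [mul_pow]
    exact le_mul_of_one_le_left (sq_nonneg _) (by nlinarith)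
  -- The square amounts to `(y - r * x)^2 ≥ y^2 / 4 - r^2 * x^2 / 3`, and `r^2 / 3 ≤ 25 / 192` lies
  -- below `1 / 4 - 1 / 10`.
  nlinarith [sq_nonneg (3 * y - 4 * r * x), mul_le_mul_of_nonneg_right hr2 (sq_nonneg x)]

/-- Where `b' = 1`, the bounds `γ + (1 - ℓ) * β ≥ 1` and `β ≥ 3 / 4` improve `β + γ ≥ 1` to `1 + 3 /
4 * ℓ`. Where `B' = 1` no such gain is available, and the added square of the w error supplies it.
The constants 1/4 and 1/10 are those of `sq_error_lower`, scaled by `κ * ℓ` so that one inequality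
covers both regions. -/
theorem pairing_lower_single (P : MParams M M₀ LF τ ε) (S : SplitPair b B)
    (C : CloseData M₀ τ b B a c) {ℓ κ : ℝ} (hℓ : 0 ≤ ℓ) (hB : ∀ t, ℓ ≤ deriv B t)
    (hκ : 0 ≤ κ) (hκ1 : κ ≤ 1) (s : ℝ) :
    mFloor M τ ε * ((1 + κ * ℓ / 4) * (s - c) ^ 2
          - (1 + κ * ℓ / 4 - κ * ℓ / 10) * (a - c) ^ 2)
        + ε * M * τ * (s - a) ^ 2 + τ * LF / 2 * ((b a - b c) * (B a - B c))
      ≤ (b a + mFactor M τ ε b a * (s - a) - b c) *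
        (B a + mFactor M τ ε B a * (s - a) - B c)
        + mFloor M τ ε * (κ * (B a + mFactor M τ ε B a * (s - a) - B c) ^ 2) := by
  have hN := mFloor_pos P
  have hℓ1 : ℓ ≤ 1 := (hB 0).trans (S.deriv_B_mem 0).2
  have hκℓ : 0 ≤ κ * ℓ := mul_nonneg hκ hℓ
  rcases S.deriv_eq_one a with h1 | h1
  · have hβ := three_quarters_le_dslope P C h1
    have h2 := le_dslope_add_mul_dslope S.diff_B S.diff_b (k := 1 - ℓ) (m := 1) (fun t => by
      have h3 := (S.deriv_b_mem t).1
      rcases S.deriv_eq_one t with h | h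
      · rw [h]; linarith [hB t]
      · rw [h]; nlinarith) a c
    have h4 := pairing_lower_of_deriv_eq_one P S C h1 (m := mFloor M τ ε * (1 + 3 / 4 * ℓ))
      (Or.inl (mul_le_mul_of_nonneg_left (by nlinarith) hN.le)) s
    have h5 : 0 ≤ mFloor M τ ε * (κ * (B a + mFactor M τ ε B a * (s - a) - B c) ^ 2) := by
      positivity
    have h6 : (1 + κ * ℓ / 4) * (s - c) ^ 2 - (1 + κ * ℓ / 4 - κ * ℓ / 10) * (a - c) ^ 2
        ≤ (1 + 3 / 4 * ℓ) * (s - c) ^ 2 - (a - c) ^ 2 := by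
      have : κ * ℓ ≤ ℓ := mul_le_of_le_one_left hℓ hκ1
      nlinarith [mul_nonneg hκℓ (sq_nonneg (a - c)),
        mul_le_mul_of_nonneg_right this (sq_nonneg (s - c)), mul_nonneg hℓ (sq_nonneg (s - c))]
    have h7 := mul_le_mul_of_nonneg_left h6 hN.le
    linarith
  · have h2 := pairing_lower_degenerate P S C s
    have h3 := sq_error_lower P S C h1 s
    generalize (B a + mFactor M τ ε B a * (s - a) - B c) = w at *
    have h4 : κ * ℓ * (((s - c) ^ 2 - (a - c) ^ 2) / 4 + (a - c) ^ 2 / 10) ≤ κ * w ^ 2 :=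
      (mul_le_mul_of_nonneg_left h3 hκℓ).trans
        (mul_le_mul_of_nonneg_right (mul_le_of_le_one_right hκ hℓ1) (sq_nonneg w))
    have h5 := mul_le_mul_of_nonneg_left h4 hN.le
    linarith

end Pointwise

end DoubleSplitting

namespace DoubleSplitting

/-! ## Consequences of the structural assumptions -/

section Structure

variable {umax : EReal} {Φ : ℝ → ℝ} {ustar : ℝ} {b B : ℝ → ℝ}

/-- Immediate on the open half-line; continuity of the derivative includes the endpoint `ustar`, so
that together with `deriv_B_eq_one` no point is missed. -/
theorem deriv_b_eq_one (hb : b = bFun umax Φ ustar) (D : IsDecomposition umax Φ b B)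
    {s : ℝ} (hs : s ≤ ustar) : deriv b s = 1 := by
  have h1 : Set.EqOn (deriv b) (fun _ => 1) (Set.Iio ustar) := fun t ht => by
    have : b =ᶠ[𝓝 t] id := by
      filter_upwards [Iio_mem_nhds ht] with r hr
      rw [hb, bFun, if_pos (le_of_lt hr), id]
    rw [this.deriv_eq, deriv_id]
  have h2 := h1.closure (D.contDiff_b.continuous_deriv le_rfl) continuous_const
  rw [closure_Iio] at h2
  exact h2 hs

theorem deriv_B_eq_one (hB : B = BFun Φ ustar) (D : IsDecomposition umax Φ b B)
    {s : ℝ} (hs : ustar ≤ s) : deriv B s = 1 := by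
  have h1 : Set.EqOn (deriv B) (fun _ => 1) (Set.Ioi ustar) := fun t ht => by
    have : B =ᶠ[𝓝 t] fun r => Φ ustar + r - ustar := by
      filter_upwards [Ioi_mem_nhds ht] with r hr
      rw [hB, BFun, if_neg (not_le.2 hr)]
    rw [this.deriv_eq]
    simp
  have h2 := h1.closure (D.contDiff_B.continuous_deriv le_rfl) continuous_const
  rw [closure_Ioi] at h2
  exact h2 hs

theorem IsDecomposition.splitPair (hb : b = bFun umax Φ ustar) (hB : B = BFun Φ ustar)
    (D : IsDecomposition umax Φ b B) : SplitPair b B :=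
  ⟨D.contDiff_b, D.contDiff_B, D.deriv_b_mem, D.deriv_B_mem, fun s =>
    (le_total s ustar).imp (deriv_b_eq_one hb D) (deriv_B_eq_one hB D)⟩

/-- `B` increases strictly to the right of every nonnegative point, and of every point if the
extension of `Φ` is strictly increasing. -/
theorem B_lt_of_lt (hΦ : DiffusionAssumption umax Φ) (hR : RegularityAssumption umax Φ ustar)
    (hB : B = BFun Φ ustar) (S : SplitPair b B) {s t : ℝ} (hst : s < t)
    (h : 0 ≤ s ∨ StrictMonoOn Φ (Set.Iio 0)) : B s < B t := by
  have hlow : ∀ r, r ≤ ustar → B r = Φ r := fun r hr => by rw [hB, BFun, if_pos hr]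
  have hpos : ∀ {s t : ℝ}, s < t → 0 < s → B s < B t := by
    intro s t hst hs
    rcases le_or_gt t ustar with ht | ht
    · rw [hlow s (hst.le.trans ht), hlow t ht]
      have htu : (t : EReal) < umax := lt_of_le_of_lt (EReal.coe_le_coe_iff.2 ht) hR.ustar_lt
      exact hΦ.strictMono ⟨hs, lt_trans (EReal.coe_lt_coe_iff.2 hst) htu⟩
        ⟨hs.trans hst, htu⟩ hst
    · have hm : max s ustar < t := max_lt hst ht
      refine (S.monotone_B (le_max_left s ustar)).trans_lt ?_
      have h1 : B (max s ustar) = Φ ustar + max s ustar - ustar := by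
        rcases le_total s ustar with h' | h'
        · rw [max_eq_right h', hlow _ le_rfl]; ring
        · rw [max_eq_left h']
          rcases h'.eq_or_lt with rfl | h''
          · rw [hlow _ le_rfl]; ring
          · rw [hB, BFun, if_neg (not_le.2 h'')]
      rw [h1, hB, BFun, if_neg (not_le.2 ht)]
      linarith
  rcases le_or_gt 0 s with hs | hs
  -- Strict monotonicity of `Φ` is assumed only on the open interval, so a midpoint separates the
  -- argument from `s = 0`.
  · refine (S.monotone_B (?_ : s ≤ (s + t) / 2)).trans_lt (hpos ?_ ?_) <;> linarith
  · have hΦ' : StrictMonoOn Φ (Set.Iio 0) := h.resolve_left (not_le.2 hs)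
    have hu := hR.ustar_pos
    have h1 : s < min t (s / 2) := lt_min hst (by linarith)
    have h2 : min t (s / 2) < 0 := (min_le_right _ _).trans_lt (by linarith)
    refine lt_of_lt_of_le ?_ (S.monotone_B (min_le_left t (s / 2)))
    rw [hlow _ (hs.le.trans hu.le), hlow _ (h2.le.trans hu.le)]
    exact hΦ' hs h2 h1

theorem nonneg_of_b_nonneg (hR : RegularityAssumption umax Φ ustar) (hb : b = bFun umax Φ ustar)
    {s : ℝ} (h : 0 ≤ b s) : 0 ≤ s := by
  by_contra! hs
  rw [hb, bFun, if_pos (hs.le.trans hR.ustar_pos.le)] at h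
  linarith

/-- The growth condition on the flux in terms of the decomposition of `Φ`. -/
theorem flux_comp_bound {d : ℕ} {F : ℝ → EuclideanSpace ℝ (Fin d)} {LF : ℝ}
    (D : IsDecomposition umax Φ b B) (S : SplitPair b B) (hF : FluxAssumption umax Φ F LF)
    (s t : ℝ) :
    ‖F (b s) - F (b t)‖ ^ 2 ≤ LF * ((b s - b t) * (B s - B t)) := by
  wlog hts : t ≤ s generalizing s t with H
  · have := H t s (le_of_not_ge hts)
    rw [norm_sub_rev]
    calc _ ≤ _ := this
      _ = _ := by ring
  have hb0 : 0 ≤ b s - b t := sub_nonneg.2 (S.monotone_b hts)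
  have hB0 : 0 ≤ B s - B t := sub_nonneg.2 (S.monotone_B hts)
  have hval : ∀ r, (b r : EReal) < umax → B r = Φ (b r) := fun r hr => by
    rcases D.comp r with h | h
    · exact h.2
    · exact absurd h.1 hr.ne
  have hmain : ∀ r, (b r : EReal) < umax → (b t : EReal) < umax → t ≤ r →
      ‖F (b r) - F (b t)‖ ^ 2 ≤ LF * ((b r - b t) * (B r - B t)) := by
    intro r hr ht htr
    have := hF.bound _ _ hr ht
    rwa [← hval r hr, ← hval t ht, abs_of_nonneg (sub_nonneg.2 (S.monotone_b htr)),
      abs_of_nonneg (sub_nonneg.2 (S.monotone_B htr)), mul_assoc] at this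
  rcases (S.monotone_b hts).eq_or_lt with heq | hlt
  · rw [heq]; simp
  have hle : ∀ r, (b r : EReal) ≤ umax := fun r => by
    rcases D.comp r with h | h
    · exact h.1.le
    · exact h.1.le
  have ht : (b t : EReal) < umax := lt_of_lt_of_le (EReal.coe_lt_coe_iff.2 hlt) (hle s)
  rcases D.comp s with hs | hs
  · exact hmain s hs.1 ht hts
  -- At `b s = umax` the value `B s` is only an upper bound for `Φ`. The estimate is proved for
  -- values `u < b s`, attained as `b r` by the intermediate value theorem, and passes to the limit
  -- through the left continuity of `F`.
  · have hbdd : BddAbove (Φ '' Set.Iio (b s)) := by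
      refine ⟨B s, ?_⟩
      rintro _ ⟨v, hv, rfl⟩
      exact hs.2 v (hs.1 ▸ EReal.coe_lt_coe_iff.2 hv)
    have hlim := hF.at_omega (b s) hs.1 hbdd
    have hlim2 : Tendsto (fun u => ‖F u - F (b t)‖ ^ 2) (𝓝[<] (b s))
        (𝓝 (‖F (b s) - F (b t)‖ ^ 2)) := ((hlim.sub_const _).norm.pow 2)
    refine le_of_tendsto hlim2 ?_
    filter_upwards [Ioo_mem_nhdsLT hlt] with u hu
    obtain ⟨r, hr, rfl⟩ := intermediate_value_Icc hts S.contDiff_b.continuous.continuousOn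
      (Set.Ioo_subset_Icc_self hu)
    have hru : (b r : EReal) < umax := hs.1 ▸ EReal.coe_lt_coe_iff.2 hu.2
    refine (hmain r hru ht hr.1).trans (mul_le_mul_of_nonneg_left ?_ hF.pos.le)
    exact mul_le_mul (sub_le_sub_right (S.monotone_b hr.2) _)
      (sub_le_sub_right (S.monotone_B hr.2) _) (sub_nonneg.2 (S.monotone_B hr.1)) hb0

theorem norm_flux_comp_sub_le {d : ℕ} {F : ℝ → EuclideanSpace ℝ (Fin d)} {LF : ℝ}
    (S : SplitPair b B) (hLF : 0 ≤ LF)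
    (hF : ∀ s t, ‖F (b s) - F (b t)‖ ^ 2 ≤ LF * ((b s - b t) * (B s - B t)))
    (s t : ℝ) : ‖F (b s) - F (b t)‖ ≤ Real.sqrt LF * |s - t| := by
  refine abs_le_of_sq_le_sq' ?_ (by positivity) |>.2
  rw [mul_pow, Real.sq_sqrt hLF]
  refine (hF s t).trans (mul_le_mul_of_nonneg_left ?_ hLF)
  calc (b s - b t) * (B s - B t) ≤ |b s - b t| * |B s - B t| := by
        rw [← abs_mul]; exact le_abs_self _
    _ ≤ |s - t| * |s - t| :=
        mul_le_mul (S.abs_sub_le s t) (S.symm.abs_sub_le s t) (abs_nonneg _) (abs_nonneg _)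
    _ = |s - t| ^ 2 := (sq _).symm

end Structure

end DoubleSplitting

namespace DoubleSplitting

/-! ## `H¹₀(Ω)`: the Poincaré inequality and density in `L²(Ω)` -/

section Sobolev

variable {d : ℕ}

local notation "𝔼" => EuclideanSpace ℝ (Fin d)

theorem norm_sq_eq_integral {α E : Type*} [MeasurableSpace α] {μ : Measure α}
    [NormedAddCommGroup E] [InnerProductSpace ℝ E] (f : Lp E 2 μ) :
    ‖f‖ ^ 2 = ∫ x, ‖f x‖ ^ 2 ∂μ := by
  rw [← real_inner_self_eq_norm_sq, L2.inner_def]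
  simp_rw [real_inner_self_eq_norm_sq]

theorem continuous_gradient {φ : 𝔼 → ℝ} (hφ : ContDiff ℝ (⊤ : ℕ∞) φ) :
    Continuous (gradient φ) :=
  (InnerProductSpace.toDual ℝ 𝔼).symm.continuous.comp (hφ.continuous_fderiv (by simp))

theorem hasCompactSupport_gradient {φ : 𝔼 → ℝ} (hφ : HasCompactSupport φ) :
    HasCompactSupport (gradient φ) :=
  (hφ.fderiv ℝ).comp_left (g := (InnerProductSpace.toDual ℝ 𝔼).symm) (map_zero _)

theorem inner_gradient {φ : 𝔼 → ℝ} (x v : 𝔼) : inner ℝ (gradient φ x) v = fderiv ℝ φ x v := by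
  simp [gradient]

/-- Integration by parts against a coordinate function. -/
theorem integral_sq_eq_neg_integral_coord_mul (i : Fin d) {φ : 𝔼 → ℝ}
    (hφ : ContDiff ℝ (⊤ : ℕ∞) φ) (hc : HasCompactSupport φ) :
    ∫ x : 𝔼, x i * (2 * φ x * fderiv ℝ φ x (EuclideanSpace.single i 1)) = -∫ x, φ x ^ 2 := by
  obtain ⟨v, hv⟩ : ∃ v : 𝔼, v = EuclideanSpace.single i 1 := ⟨_, rfl⟩
  rw [← hv]
  have hdiff : Differentiable ℝ φ := hφ.differentiable (by simp)
  have hφc : Continuous φ := hφ.continuous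
  have hd2 : ∀ x, fderiv ℝ (fun y => φ y ^ 2) x v = 2 * φ x * fderiv ℝ φ x v := by
    intro x
    rw [((hdiff x).hasFDerivAt.pow 2).fderiv]
    simp
  have hfd : Continuous fun x => fderiv ℝ φ x v :=
    (hφ.continuous_fderiv (by simp)).clm_apply continuous_const
  have hproj : Continuous fun x : 𝔼 => x i := by fun_prop
  have hpd : ∀ x : 𝔼, HasFDerivAt (fun x : 𝔼 => x i) (EuclideanSpace.proj i : 𝔼 →L[ℝ] ℝ) x :=
    fun x => (EuclideanSpace.proj i : 𝔼 →L[ℝ] ℝ).hasFDerivAt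
  have hfp : ∀ x : 𝔼, fderiv ℝ (fun x : 𝔼 => x i) x v = 1 := by
    intro x
    rw [(hpd x).fderiv]
    simp [hv]
  have hcs : HasCompactSupport fun x => φ x ^ 2 := by
    have h : HasCompactSupport (φ * φ) := hc.mul_right
    simp only [pow_two]
    exact h
  have hint : Integrable fun x => φ x ^ 2 := (hφc.pow 2).integrable_of_hasCompactSupport hcs
  have hcs3 : HasCompactSupport fun x : 𝔼 => x i * (2 * φ x * fderiv ℝ φ x v) := by
    have h : HasCompactSupport fun x : 𝔼 => φ x * (x i * 2 * fderiv ℝ φ x v) := hc.mul_right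
    convert h using 2
    ring
  have hint3 : Integrable fun x : 𝔼 => x i * (2 * φ x * fderiv ℝ φ x v) :=
    (hproj.mul ((continuous_const.mul hφc).mul hfd)).integrable_of_hasCompactSupport hcs3
  have hint4 : Integrable fun x : 𝔼 => x i * φ x ^ 2 :=
    (hproj.mul (hφc.pow 2)).integrable_of_hasCompactSupport hcs.mul_left
  have hint5 : Integrable fun x : 𝔼 => fderiv ℝ (fun x : 𝔼 => x i) x v * φ x ^ 2 := by
    simpa only [hfp, one_mul] using hint
  have hint6 : Integrable fun x : 𝔼 => x i * fderiv ℝ (fun y => φ y ^ 2) x v := by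
    simpa only [hd2] using hint3
  have hsq : ∀ x, DifferentiableAt ℝ (fun y => φ y ^ 2) x := fun x => (hdiff x).pow 2
  have key := integral_mul_fderiv_eq_neg_fderiv_mul_of_integrable hint5 hint6 hint4
    (fun x _ => (hpd x).differentiableAt) (fun x _ => hsq x)
  simpa only [hfp, hd2, one_mul] using key

/-- The Poincaré inequality for test functions. -/
theorem integral_sq_le_integral_gradient_sq (i : Fin d) {φ : 𝔼 → ℝ}
    (hφ : ContDiff ℝ (⊤ : ℕ∞) φ) (hc : HasCompactSupport φ) {R : ℝ}
    (hR : ∀ x, φ x ≠ 0 → ‖x‖ ≤ R) :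
    ∫ x, φ x ^ 2 ≤ 4 * R ^ 2 * ∫ x, ‖gradient φ x‖ ^ 2 := by
  have key := integral_sq_eq_neg_integral_coord_mul i hφ hc
  set v : 𝔼 := EuclideanSpace.single i 1 with hv
  have hφc : Continuous φ := hφ.continuous
  have hfd : Continuous fun x => fderiv ℝ φ x v :=
    (hφ.continuous_fderiv (by simp)).clm_apply continuous_const
  have hproj : Continuous fun x : 𝔼 => x i := by fun_prop
  have hcs : HasCompactSupport fun x => φ x ^ 2 := by
    have h : HasCompactSupport (φ * φ) := hc.mul_right
    simp only [pow_two]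
    exact h
  have hint : Integrable fun x => φ x ^ 2 := (hφc.pow 2).integrable_of_hasCompactSupport hcs
  have hcs3 : HasCompactSupport fun x : 𝔼 => x i * (2 * φ x * fderiv ℝ φ x v) := by
    have h : HasCompactSupport fun x : 𝔼 => φ x * (x i * 2 * fderiv ℝ φ x v) := hc.mul_right
    convert h using 2
    ring
  have hint3 : Integrable fun x : 𝔼 => x i * (2 * φ x * fderiv ℝ φ x v) :=
    (hproj.mul ((continuous_const.mul hφc).mul hfd)).integrable_of_hasCompactSupport hcs3
  have hgc : Integrable fun x => ‖gradient φ x‖ ^ 2 := by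
    refine ((continuous_gradient hφ).norm.pow 2).integrable_of_hasCompactSupport ?_
    have h := (hasCompactSupport_gradient hc).norm
    have h2 : HasCompactSupport ((fun x => ‖gradient φ x‖) * fun x => ‖gradient φ x‖) :=
      h.mul_right
    simp only [pow_two]
    exact h2
  have hpt : ∀ x : 𝔼, -(x i * (2 * φ x * fderiv ℝ φ x v))
      ≤ φ x ^ 2 / 2 + 2 * R ^ 2 * ‖gradient φ x‖ ^ 2 := by
    intro x
    rcases eq_or_ne (φ x) 0 with h0 | h0
    · rw [h0]; simp; positivity
    · have h1 : |x i| ≤ R := (PiLp.norm_apply_le x i).trans (hR x h0)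
      have h2 : |fderiv ℝ φ x v| ≤ ‖gradient φ x‖ := by
        rw [← inner_gradient]
        refine (abs_real_inner_le_norm _ _).trans ?_
        simp [hv]
      have h3 : |x i * fderiv ℝ φ x v| ≤ R * ‖gradient φ x‖ := by
        rw [abs_mul]
        exact mul_le_mul h1 h2 (abs_nonneg _) ((abs_nonneg _).trans h1)
      have h4 := sq_le_sq' (abs_le.1 h3).1 (abs_le.1 h3).2
      -- Young's inequality `-2 * φ * t ≤ φ^2 / 2 + 2 * t^2` with `t` the coordinate times the
      -- partial derivative; half of the φ integral is later absorbed on the left, whence the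
      -- constant `4 * R^2`.
      nlinarith [sq_nonneg (φ x + 2 * (x i * fderiv ℝ φ x v))]
  have h5 : ∫ x : 𝔼, -(x i * (2 * φ x * fderiv ℝ φ x v))
      ≤ ∫ x, (φ x ^ 2 / 2 + 2 * R ^ 2 * ‖gradient φ x‖ ^ 2) :=
    integral_mono hint3.neg ((hint.div_const 2).add (hgc.const_mul _)) hpt
  rw [integral_neg, key, neg_neg, integral_add (hint.div_const 2) (hgc.const_mul _),
    integral_div, integral_const_mul] at h5
  linarith

/-- `testPairs Ω` is a subspace. -/
def testSubmodule (Ω : Set 𝔼) : Submodule ℝ (L2 Ω × L2Vec Ω) where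
  carrier := testPairs Ω
  zero_mem' := ⟨fun _ => 0, contDiff_const, HasCompactSupport.zero, by
      simp, Lp.coeFn_zero _ _ _, by
      rw [gradient_fun_const']; exact Lp.coeFn_zero _ _ _⟩
  add_mem' := by
    rintro p q ⟨φ, h1, h2, h3, h4, h5⟩ ⟨ψ, k1, k2, k3, k4, k5⟩
    refine ⟨φ + ψ, h1.add k1, h2.add k2, (tsupport_add _ _).trans (Set.union_subset h3 k3),
      (Lp.coeFn_add _ _).trans (h4.add k4), (Lp.coeFn_add _ _).trans ((h5.add k5).trans ?_)⟩
    refine Eventually.of_forall fun x => ?_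
    simp [gradient, fderiv_add (h1.differentiable (by simp) x) (k1.differentiable (by simp) x)]
  smul_mem' := by
    rintro c p ⟨φ, h1, h2, h3, h4, h5⟩
    refine ⟨c • φ, contDiff_const.smul h1, h2.smul_left (f := fun _ => c),
      (closure_mono (Function.support_const_smul_subset c φ)).trans h3,
      (Lp.coeFn_smul _ _).trans (h4.const_smul c),
      (Lp.coeFn_smul _ _).trans ((h5.const_smul c).trans ?_)⟩
    refine Eventually.of_forall fun x => ?_
    simp [gradient, fderiv_const_smul (h1.differentiable (by simp) x)]

theorem H10_eq_closure (Ω : Set 𝔼) : H10 Ω = (testSubmodule Ω).topologicalClosure := by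
  rw [H10, show testPairs Ω = (testSubmodule Ω : Set _) from rfl, Submodule.span_eq]

/-- The inequality is a closed condition on pairs, so it passes from test pairs to their closure.
This uses that test pairs already form a subspace, as the inequality would not survive taking a
span. -/
theorem exists_poincare (hd : 0 < d) {Ω : Set 𝔼} (hΩb : Bornology.IsBounded Ω) :
    ∃ C : ℝ, 0 < C ∧ ∀ w : H10 Ω, ‖H10.fn w‖ ^ 2 ≤ C * ‖H10.grad w‖ ^ 2 := by
  obtain ⟨R, hRpos, hR⟩ := hΩb.exists_pos_norm_le
  refine ⟨4 * R ^ 2, by positivity, fun w => ?_⟩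
  have hcl : IsClosed {p : L2 Ω × L2Vec Ω | ‖p.1‖ ^ 2 ≤ 4 * R ^ 2 * ‖p.2‖ ^ 2} :=
    isClosed_le (by fun_prop) (by fun_prop)
  have hsub : (testSubmodule Ω : Set (L2 Ω × L2Vec Ω))
      ⊆ {p | ‖p.1‖ ^ 2 ≤ 4 * R ^ 2 * ‖p.2‖ ^ 2} := by
    rintro p ⟨φ, h1, h2, h3, h4, h5⟩
    have hsupp : ∀ x, x ∉ Ω → φ x = 0 := fun x hx =>
      image_eq_zero_of_notMem_tsupport fun h => hx (h3 h)
    have e1 : ‖p.1‖ ^ 2 = ∫ x, φ x ^ 2 := by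
      rw [norm_sq_eq_integral, ← setIntegral_eq_integral_of_forall_compl_eq_zero
        (f := fun x => φ x ^ 2) (s := Ω) fun x hx => by rw [hsupp x hx]; simp]
      refine integral_congr_ae ?_
      filter_upwards [h4] with x hx
      rw [hx, Real.norm_eq_abs, sq_abs]
    have e2 : ‖p.2‖ ^ 2 = ∫ x, ‖gradient φ x‖ ^ 2 := by
      rw [norm_sq_eq_integral, ← setIntegral_eq_integral_of_forall_compl_eq_zero
        (f := fun x => ‖gradient φ x‖ ^ 2) (s := Ω) fun x hx => ?_]
      · refine integral_congr_ae ?_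
        filter_upwards [h5] with x hx
        rw [hx]
      · have : fderiv ℝ φ x = 0 := by
          by_contra hne
          exact hx (h3 (support_fderiv_subset ℝ hne))
        simp [gradient, this]
    change ‖p.1‖ ^ 2 ≤ 4 * R ^ 2 * ‖p.2‖ ^ 2
    rw [e1, e2]
    exact integral_sq_le_integral_gradient_sq ⟨0, hd⟩ h1 h2 fun x hx =>
      hR x (by_contra fun h => hx (hsupp x h))
  have hw : w.1 ∈ (testSubmodule Ω).topologicalClosure := H10_eq_closure Ω ▸ w.2
  exact closure_minimal hsub hcl hw

/-- A test function as an element of `H¹₀(Ω)`. -/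
theorem exists_H10_of_test {Ω : Set 𝔼} {φ : 𝔼 → ℝ} (h1 : ContDiff ℝ (⊤ : ℕ∞) φ)
    (h2 : HasCompactSupport φ) (h3 : tsupport φ ⊆ Ω) :
    ∃ w : H10 Ω, H10.fn w =ᵐ[volume.restrict Ω] φ := by
  have m1 : MemLp φ 2 (volume.restrict Ω) := h1.continuous.memLp_of_hasCompactSupport h2
  have m2 : MemLp (gradient φ) 2 (volume.restrict Ω) :=
    (continuous_gradient h1).memLp_of_hasCompactSupport (hasCompactSupport_gradient h2)
  refine ⟨⟨(m1.toLp φ, m2.toLp _), Submodule.le_topologicalClosure _ (Submodule.subset_span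
    ⟨φ, h1, h2, h3, m1.coeFn_toLp, m2.coeFn_toLp⟩)⟩, m1.coeFn_toLp⟩

/-- An element orthogonal to all test functions vanishes by the fundamental lemma of the calculus of
variations. -/
theorem denseRange_fn {Ω : Set 𝔼} (hΩ : IsOpen Ω) : DenseRange (H10.fn (Ω := Ω)) := by
  set K : Submodule ℝ (L2 Ω) := (H10 Ω).map (LinearMap.fst ℝ (L2 Ω) (L2Vec Ω)) with hK
  have hmem : ∀ w : H10 Ω, H10.fn w ∈ K := fun w => ⟨w.1, w.2, rfl⟩
  have hKset : (K : Set (L2 Ω)) = Set.range (H10.fn (Ω := Ω)) := by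
    ext v
    constructor
    · rintro ⟨p, hp, rfl⟩
      exact ⟨⟨p, hp⟩, rfl⟩
    · rintro ⟨w, rfl⟩
      exact hmem w
  have horth : Kᗮ = ⊥ := by
    rw [Submodule.eq_bot_iff]
    intro v hv
    have hloc : LocallyIntegrableOn (v : 𝔼 → ℝ) Ω volume := by
      rw [locallyIntegrableOn_iff hΩ.isLocallyClosed]
      intro k hk hkc
      have hm : MemLp (v : 𝔼 → ℝ) 2 (volume.restrict k) :=
        (Lp.memLp v).mono_measure (Measure.restrict_mono hk le_rfl)
      have : IsFiniteMeasure ((volume : Measure 𝔼).restrict k) :=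
        ⟨by rw [Measure.restrict_apply_univ]; exact hkc.measure_lt_top⟩
      exact hm.integrable one_le_two
    have hz := hΩ.ae_eq_zero_of_integral_contDiff_smul_eq_zero hloc fun g g1 g2 g3 => by
      obtain ⟨w, hw⟩ := exists_H10_of_test g1 g2 g3
      have h0 := (Submodule.mem_orthogonal K v).1 hv _ (hmem w)
      rw [L2.inner_def] at h0
      rw [← setIntegral_eq_integral_of_forall_compl_eq_zero (s := Ω) fun x hx => by
        rw [image_eq_zero_of_notMem_tsupport fun h => hx (g3 h), zero_smul]]
      rw [← h0]
      refine integral_congr_ae ?_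
      filter_upwards [hw] with x hx
      rw [hx]
      simp [mul_comm]
    refine Lp.eq_zero_iff_ae_eq_zero.2 ?_
    exact (ae_restrict_iff' hΩ.measurableSet).2 hz
  have := (Submodule.topologicalClosure_eq_top_iff).2 horth
  rw [DenseRange, ← hKset]
  exact Submodule.dense_iff_topologicalClosure_eq_top.2 this

end Sobolev

end DoubleSplitting

namespace DoubleSplitting

/-! ## Error equations and the energy inequality -/

section Energy

variable {d : ℕ} {Ω : Set (EuclideanSpace ℝ (Fin d))}

theorem memLp_comp_of_lipschitz {E : Type*} [NormedAddCommGroup E]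
    [IsFiniteMeasure (volume.restrict Ω)] {g : ℝ → E} {K : ℝ} (hK : 0 ≤ K)
    (hg : ∀ s t, ‖g s - g t‖ ≤ K * |s - t|) (s : L2 Ω) :
    MemLp (fun x => g (s x)) 2 (volume.restrict Ω) := by
  have hc : Continuous g := (LipschitzWith.of_dist_le_mul (K := ⟨K, hK⟩) fun x y => by
    rw [dist_eq_norm, Real.dist_eq]; exact hg x y).continuous
  have hs : MemLp (fun x => K * ‖s x‖ + ‖g 0‖) 2 (volume.restrict Ω) :=
    ((Lp.memLp s).norm.const_mul K).add (memLp_const _)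
  refine hs.mono (hc.comp_aestronglyMeasurable (Lp.aestronglyMeasurable s))
    (Eventually.of_forall fun x => ?_)
  have h1 := hg (s x) 0
  rw [sub_zero] at h1
  have h2 := norm_le_norm_sub_add (g (s x)) (g 0)
  rw [Real.norm_of_nonneg (by positivity), Real.norm_eq_abs]
  linarith

theorem SplitPair.memLp_b {b B : ℝ → ℝ} (S : SplitPair b B)
    [IsFiniteMeasure (volume.restrict Ω)] (s : L2 Ω) :
    MemLp (fun x => b (s x)) 2 (volume.restrict Ω) :=
  memLp_comp_of_lipschitz zero_le_one (fun s t => by rw [one_mul]; exact S.abs_sub_le s t) s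

/-- The superposition operator of `b` on `L²(Ω)`. -/
noncomputable def SplitPair.toL2 {b B : ℝ → ℝ} (S : SplitPair b B)
    [IsFiniteMeasure (volume.restrict Ω)] (s : L2 Ω) : L2 Ω := (S.memLp_b s).toLp _

theorem SplitPair.coeFn_toL2 {b B : ℝ → ℝ} (S : SplitPair b B)
    [IsFiniteMeasure (volume.restrict Ω)] (s : L2 Ω) :
    S.toL2 s =ᵐ[volume.restrict Ω] fun x => b (s x) := (S.memLp_b s).coeFn_toLp

theorem SplitPair.coeFn_toL2_sub {b B : ℝ → ℝ} (S : SplitPair b B)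
    [IsFiniteMeasure (volume.restrict Ω)] (s t : L2 Ω) :
    (S.toL2 s - S.toL2 t : L2 Ω) =ᵐ[volume.restrict Ω] fun x => b (s x) - b (t x) :=
  (Lp.coeFn_sub _ _).trans ((S.coeFn_toL2 s).sub (S.coeFn_toL2 t))

theorem SplitPair.norm_toL2_sub_le {b B : ℝ → ℝ} (S : SplitPair b B)
    [IsFiniteMeasure (volume.restrict Ω)] (s t : L2 Ω) : ‖S.toL2 s - S.toL2 t‖ ≤ ‖s - t‖ := by
  refine Lp.norm_le_norm_of_ae_le ?_
  filter_upwards [S.coeFn_toL2_sub s t, Lp.coeFn_sub s t] with x h1 h2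
  rw [h1, h2]
  exact S.abs_sub_le _ _

theorem continuous_mFactor {M τ ε : ℝ} {b B : ℝ → ℝ} (S : SplitPair b B) :
    Continuous (mFactor M τ ε b) := by
  have := S.contDiff_b.continuous_deriv le_rfl
  unfold mFactor
  fun_prop

theorem abs_mFactor_le {M M₀ LF τ ε : ℝ} (P : MParams M M₀ LF τ ε) (b : ℝ → ℝ) (t : ℝ) :
    |mFactor M τ ε b t| ≤ 1 + ε := by
  rw [abs_of_nonneg ((mul_nonneg zero_le_two (mFloor_pos P).le).trans
    (two_mul_mFloor_le_mFactor M τ ε b t))]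
  exact min_le_right _ _

theorem ae_eq_of_integral_mul_eq {g h : EuclideanSpace ℝ (Fin d) → ℝ}
    (hg : MemLp g 2 (volume.restrict Ω)) (hh : MemLp h 2 (volume.restrict Ω))
    (H : ∀ φ : L2 Ω, ∫ x in Ω, g x * φ x = ∫ x in Ω, h x * φ x) :
    g =ᵐ[volume.restrict Ω] h := by
  have key : hg.toLp g - hh.toLp h = 0 := by
    rw [← inner_self_eq_zero (𝕜 := ℝ)]
    set φ := hg.toLp g - hh.toLp h
    have e1 : inner ℝ φ (hg.toLp g) = ∫ x in Ω, g x * φ x := by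
      rw [L2.inner_def]
      refine integral_congr_ae ?_
      filter_upwards [hg.coeFn_toLp] with x hx
      simp [hx]
    have e2 : inner ℝ φ (hh.toLp h) = ∫ x in Ω, h x * φ x := by
      rw [L2.inner_def]
      refine integral_congr_ae ?_
      filter_upwards [hh.coeFn_toLp] with x hx
      simp [hx]
    rw [show inner ℝ φ φ = inner ℝ φ (hg.toLp g) - inner ℝ φ (hh.toLp h) from
      inner_sub_right _ _ _, e1, e2, H φ, sub_self]
  exact (MemLp.toLp_eq_toLp_iff hg hh).1 (sub_eq_zero.1 key)

theorem norm_sub_sq_eq_integral (f g : L2 Ω) : ‖f - g‖ ^ 2 = ∫ x in Ω, (f x - g x) ^ 2 := by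
  rw [norm_sq_eq_integral]
  refine integral_congr_ae ?_
  filter_upwards [Lp.coeFn_sub f g] with x hx
  rw [hx, Pi.sub_apply, Real.norm_eq_abs, sq_abs]

theorem inner_sub_sub_eq_integral (f g h k : L2 Ω) :
    inner ℝ (f - g) (h - k) = ∫ x in Ω, (f x - g x) * (h x - k x) := by
  rw [L2.inner_def]
  refine integral_congr_ae ?_
  filter_upwards [Lp.coeFn_sub f g, Lp.coeFn_sub h k] with x h1 h2
  rw [h1, h2]
  simp
  ring

theorem integrable_sub_mul_sub (f g h k : L2 Ω) :
    Integrable (fun x => (f x - g x) * (h x - k x)) (volume.restrict Ω) :=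
  ((Lp.memLp f).sub (Lp.memLp g)).integrable_mul ((Lp.memLp h).sub (Lp.memLp k))

theorem integrable_sub_sq (f g : L2 Ω) :
    Integrable (fun x => (f x - g x) ^ 2) (volume.restrict Ω) :=
  ((Lp.memLp f).sub (Lp.memLp g)).integrable_sq

theorem memLp_mFactor_mul {b B : ℝ → ℝ} {M M₀ LF τ ε : ℝ} (P : MParams M M₀ LF τ ε) (S : SplitPair b B) (a s : L2 Ω) :
    MemLp (fun x => mFactor M τ ε b (a x) * (s x - a x)) 2 (volume.restrict Ω) := by
  have h1 : MemLp (fun x => s x - a x) 2 (volume.restrict Ω) := (Lp.memLp s).sub (Lp.memLp a)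
  refine h1.of_le_mul (c := 1 + ε) (((continuous_mFactor S).comp_aestronglyMeasurable
    (Lp.aestronglyMeasurable a)).mul h1.aestronglyMeasurable) (Eventually.of_forall fun x => ?_)
  rw [norm_mul]
  exact mul_le_mul_of_nonneg_right (abs_mFactor_le P b _) (norm_nonneg _)

/-- The balance equations as identities in the Hilbert spaces `L²(Ω)` and `L²(Ω; ℝᵈ)`. -/
theorem inner_balance {τ : ℝ} {uPrev : L2 Ω} {φ w : H10 Ω} {Fs : EuclideanSpace ℝ (Fin d) → EuclideanSpace ℝ (Fin d)}
    (hFs : MemLp Fs 2 (volume.restrict Ω)) {u : L2 Ω} {r : ℝ}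
    (h : (∫ x in Ω, (1 / τ) * (u x - uPrev x) * H10.fn φ x)
        + (∫ x in Ω, inner ℝ (H10.grad w x) (H10.grad φ x))
      = (∫ x in Ω, inner ℝ (Fs x) (H10.grad φ x)) + r) :
    1 / τ * inner ℝ (u - uPrev) (H10.fn φ) + inner ℝ (H10.grad w) (H10.grad φ)
      = inner ℝ (hFs.toLp Fs) (H10.grad φ) + r := by
  rw [L2.inner_def, L2.inner_def, L2.inner_def, ← integral_const_mul]
  have e1 : ∫ x in Ω, 1 / τ * inner ℝ ((u - uPrev : L2 Ω) x) (H10.fn φ x)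
      = ∫ x in Ω, (1 / τ) * (u x - uPrev x) * H10.fn φ x := by
    refine integral_congr_ae ?_
    filter_upwards [Lp.coeFn_sub u uPrev] with x hx
    rw [hx]
    simp
    ring
  have e2 : ∫ x in Ω, inner ℝ (hFs.toLp Fs x) (H10.grad φ x)
      = ∫ x in Ω, inner ℝ (Fs x) (H10.grad φ x) := by
    refine integral_congr_ae ?_
    filter_upwards [hFs.coeFn_toLp] with x hx
    rw [hx]
  rw [e1, e2]
  exact h

/-! ### Almost everywhere relations, error equation and one-step estimates -/

section Ae

variable {F : ℝ → EuclideanSpace ℝ (Fin d)} {b B : ℝ → ℝ} {M M₀ LF τ ε : ℝ} {f : HMinusOne Ω}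
  {uPrev sn un a s u : L2 Ω} {wn w : H10 Ω} [IsFiniteMeasure (volume.restrict Ω)]

theorem IsWeakSolution.u_ae (S : SplitPair b B)
    (W : IsWeakSolution Ω F b B τ f uPrev sn un wn) :
    un =ᵐ[volume.restrict Ω] fun x => b (sn x) :=
  ae_eq_of_integral_mul_eq (Lp.memLp un) (S.memLp_b sn) W.u_eq

theorem IsWeakSolution.w_ae (S : SplitPair b B)
    (W : IsWeakSolution Ω F b B τ f uPrev sn un wn) :
    H10.fn wn =ᵐ[volume.restrict Ω] fun x => B (sn x) :=
  ae_eq_of_integral_mul_eq (Lp.memLp _) (S.symm.memLp_b sn) W.w_eq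

theorem IsLinearizedStep.u_ae (P : MParams M M₀ LF τ ε) (S : SplitPair b B)
    (T : IsLinearizedStep Ω F b B (mFactor M τ ε b) (mFactor M τ ε B) τ f uPrev a s u w) :
    u =ᵐ[volume.restrict Ω] fun x => b (a x) + mFactor M τ ε b (a x) * (s x - a x) := by
  have h := ae_eq_of_integral_mul_eq (g := fun x => u x - b (a x))
    ((Lp.memLp u).sub (S.memLp_b a)) (memLp_mFactor_mul P S a s) T.u_eq
  filter_upwards [h] with x hx
  linarith

theorem IsLinearizedStep.w_ae (P : MParams M M₀ LF τ ε) (S : SplitPair b B)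
    (T : IsLinearizedStep Ω F b B (mFactor M τ ε b) (mFactor M τ ε B) τ f uPrev a s u w) :
    H10.fn w =ᵐ[volume.restrict Ω] fun x => B (a x) + mFactor M τ ε B (a x) * (s x - a x) := by
  have h := ae_eq_of_integral_mul_eq (g := fun x => H10.fn w x - B (a x))
    ((Lp.memLp _).sub (S.symm.memLp_b a)) (memLp_mFactor_mul P S.symm a s) T.w_eq
  filter_upwards [h] with x hx
  linarith

/-- The linearization residual is controlled by the increment, so vanishing increments let u be
replaced by `b` of the previous iterate. -/
theorem IsLinearizedStep.norm_u_sub_le (P : MParams M M₀ LF τ ε) (S : SplitPair b B)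
    (T : IsLinearizedStep Ω F b B (mFactor M τ ε b) (mFactor M τ ε B) τ f uPrev a s u w) :
    ‖u - S.toL2 a‖ ≤ (1 + ε) * ‖s - a‖ := by
  refine Lp.norm_le_mul_norm_of_ae_le_mul ?_
  filter_upwards [T.u_ae P S, Lp.coeFn_sub u (S.toL2 a), Lp.coeFn_sub s a, S.coeFn_toL2 a]
    with x h1 h2 h3 h4
  rw [h2, h3, Pi.sub_apply, Pi.sub_apply, h1, h4, add_sub_cancel_left, norm_mul]
  exact mul_le_mul_of_nonneg_right (abs_mFactor_le P b _) (norm_nonneg _)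

theorem IsLinearizedStep.norm_w_sub_le (P : MParams M M₀ LF τ ε) (S : SplitPair b B)
    (T : IsLinearizedStep Ω F b B (mFactor M τ ε b) (mFactor M τ ε B) τ f uPrev a s u w) :
    ‖H10.fn w - S.symm.toL2 a‖ ≤ (1 + ε) * ‖s - a‖ := by
  refine Lp.norm_le_mul_norm_of_ae_le_mul ?_
  filter_upwards [T.w_ae P S, Lp.coeFn_sub (H10.fn w) (S.symm.toL2 a), Lp.coeFn_sub s a,
    S.symm.coeFn_toL2 a] with x h1 h2 h3 h4
  rw [h2, h3, Pi.sub_apply, Pi.sub_apply, h1, h4, add_sub_cancel_left, norm_mul]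
  exact mul_le_mul_of_nonneg_right (abs_mFactor_le P B _) (norm_nonneg _)

theorem memLp_flux (S : SplitPair b B) (hLF : 0 ≤ LF)
    (hF : ∀ s t, ‖F (b s) - F (b t)‖ ^ 2 ≤ LF * ((b s - b t) * (B s - B t))) (s : L2 Ω) :
    MemLp (fun x => F (b (s x))) 2 (volume.restrict Ω) :=
  memLp_comp_of_lipschitz (g := fun t => F (b t)) (Real.sqrt_nonneg LF)
    (norm_flux_comp_sub_le S hLF hF) s

/-- Subtracting the two balance equations cancels `f` and `uPrev`. -/
theorem error_balance (S : SplitPair b B) (hLF : 0 ≤ LF)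
    (hF : ∀ s t, ‖F (b s) - F (b t)‖ ^ 2 ≤ LF * ((b s - b t) * (B s - B t)))
    (W : IsWeakSolution Ω F b B τ f uPrev sn un wn) {Lb LB : ℝ → ℝ}
    (T : IsLinearizedStep Ω F b B Lb LB τ f uPrev a s u w) (φ : H10 Ω) :
    1 / τ * inner ℝ (u - un) (H10.fn φ) + inner ℝ (H10.grad (w - wn)) (H10.grad φ)
      = inner ℝ ((memLp_flux S hLF hF a).toLp _ - (memLp_flux S hLF hF sn).toLp _)
        (H10.grad φ) := by
  have h1 := inner_balance (memLp_flux S hLF hF sn) (W.balance φ)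
  have h2 := inner_balance (memLp_flux S hLF hF a) (T.balance φ)
  have e1 : inner ℝ (u - un) (H10.fn φ)
      = inner ℝ (u - uPrev) (H10.fn φ) - inner ℝ (un - uPrev) (H10.fn φ) := by
    rw [← inner_sub_left, sub_sub_sub_cancel_right]
  have e2 : inner ℝ (H10.grad (w - wn)) (H10.grad φ)
      = inner ℝ (H10.grad w) (H10.grad φ) - inner ℝ (H10.grad wn) (H10.grad φ) :=
    inner_sub_left _ _ _
  rw [e1, e2, inner_sub_left ((memLp_flux S hLF hF a).toLp _)]
  linarith

theorem norm_flux_sub_sq_le (S : SplitPair b B) (hLF : 0 ≤ LF)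
    (hF : ∀ s t, ‖F (b s) - F (b t)‖ ^ 2 ≤ LF * ((b s - b t) * (B s - B t))) (s t : L2 Ω) :
    ‖(memLp_flux S hLF hF s).toLp _ - (memLp_flux S hLF hF t).toLp _‖ ^ 2
      ≤ LF * inner ℝ (S.toL2 s - S.toL2 t) (S.symm.toL2 s - S.symm.toL2 t) := by
  rw [norm_sq_eq_integral, inner_sub_sub_eq_integral, ← integral_const_mul]
  refine integral_mono_ae (Lp.memLp _).integrable_norm_pow' ?_ ?_
  · exact (integrable_sub_mul_sub _ _ _ _).const_mul _
  · filter_upwards [Lp.coeFn_sub ((memLp_flux S hLF hF s).toLp _)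
      ((memLp_flux S hLF hF t).toLp _), (memLp_flux S hLF hF s).coeFn_toLp,
      (memLp_flux S hLF hF t).coeFn_toLp, S.coeFn_toL2 s, S.coeFn_toL2 t, S.symm.coeFn_toL2 s,
      S.symm.coeFn_toL2 t] with x h1 h2 h3 h4 h5 h6 h7
    rw [h1, Pi.sub_apply, h2, h3, h4, h5, h6, h7]
    exact hF _ _

/-- The energy inequality for the error of one linearization step. -/
theorem energy_le (P : MParams M M₀ LF τ ε) (S : SplitPair b B)
    (hF : ∀ s t, ‖F (b s) - F (b t)‖ ^ 2 ≤ LF * ((b s - b t) * (B s - B t)))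
    (W : IsWeakSolution Ω F b B τ f uPrev sn un wn) {Lb LB : ℝ → ℝ}
    (T : IsLinearizedStep Ω F b B Lb LB τ f uPrev a s u w) :
    inner ℝ (u - un) (H10.fn w - H10.fn wn) + τ / 2 * ‖H10.grad (w - wn)‖ ^ 2
      ≤ τ * LF / 2 * inner ℝ (S.toL2 a - S.toL2 sn) (S.symm.toL2 a - S.symm.toL2 sn) := by
  have hτ := P.τ_pos
  -- The test function is the error in w itself; Young's inequality then leaves half of the gradient
  -- term.
  have h1 := error_balance S P.LF_pos.le hF W T (w - wn)
  have h2 := norm_flux_sub_sq_le S P.LF_pos.le hF a sn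
  rw [real_inner_self_eq_norm_sq, show H10.fn (w - wn) = H10.fn w - H10.fn wn from rfl] at h1
  set D := (memLp_flux S P.LF_pos.le hF a).toLp _ - (memLp_flux S P.LF_pos.le hF sn).toLp _
  have h3 := real_inner_le_norm D (H10.grad (w - wn))
  have h4 : τ * (1 / τ * inner ℝ (u - un) (H10.fn w - H10.fn wn) + ‖H10.grad (w - wn)‖ ^ 2)
      = inner ℝ (u - un) (H10.fn w - H10.fn wn) + τ * ‖H10.grad (w - wn)‖ ^ 2 := by
    field_simp
  have h5 : inner ℝ D (H10.grad (w - wn)) ≤ ‖D‖ ^ 2 / 2 + ‖H10.grad (w - wn)‖ ^ 2 / 2 := by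
    nlinarith [sq_nonneg (‖D‖ - ‖H10.grad (w - wn)‖)]
  have h6 := mul_le_mul_of_nonneg_left (h1.le.trans h5) hτ.le
  have h7 := mul_le_mul_of_nonneg_left h2 hτ.le
  rw [h4] at h6
  linarith

/-- Integration of a pointwise lower bound for the product of the errors. -/
theorem error_estimate (P : MParams M M₀ LF τ ε) (S : SplitPair b B)
    (hF : ∀ s t, ‖F (b s) - F (b t)‖ ^ 2 ≤ LF * ((b s - b t) * (B s - B t)))
    (W : IsWeakSolution Ω F b B τ f uPrev sn un wn)
    (T : IsLinearizedStep Ω F b B (mFactor M τ ε b) (mFactor M τ ε B) τ f uPrev a s u w)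
    {m n k j : ℝ}
    (H : ∀ᵐ x ∂(volume.restrict Ω),
      m * (s x - sn x) ^ 2 - n * (a x - sn x) ^ 2 + k * (s x - a x) ^ 2
          + τ * LF / 2 * ((b (a x) - b (sn x)) * (B (a x) - B (sn x)))
        ≤ (b (a x) + mFactor M τ ε b (a x) * (s x - a x) - b (sn x)) *
            (B (a x) + mFactor M τ ε B (a x) * (s x - a x) - B (sn x))
          + j * (B (a x) + mFactor M τ ε B (a x) * (s x - a x) - B (sn x)) ^ 2) :
    m * ‖s - sn‖ ^ 2 - n * ‖a - sn‖ ^ 2 + k * ‖s - a‖ ^ 2 + τ / 2 * ‖H10.grad (w - wn)‖ ^ 2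
      ≤ j * ‖H10.fn w - H10.fn wn‖ ^ 2 := by
  have h1 := energy_le P S hF W T
  have i1 := (integrable_sub_sq s sn).const_mul m
  have i2 := (integrable_sub_sq a sn).const_mul n
  have i3 := (integrable_sub_sq s a).const_mul k
  have i4 := (integrable_sub_mul_sub (S.toL2 a) (S.toL2 sn) (S.symm.toL2 a)
    (S.symm.toL2 sn)).const_mul (τ * LF / 2)
  have i5 := integrable_sub_mul_sub u un (H10.fn w) (H10.fn wn)
  have i6 := (integrable_sub_sq (H10.fn w) (H10.fn wn)).const_mul j
  have key := integral_mono_ae (((i1.sub i2).add i3).add i4) (i5.add i6) (by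
    filter_upwards [H, T.u_ae P S, T.w_ae P S, W.u_ae S, W.w_ae S, S.coeFn_toL2 a,
      S.coeFn_toL2 sn, S.symm.coeFn_toL2 a, S.symm.coeFn_toL2 sn]
      with x h h1 h2 h3 h4 h5 h6 h7 h8
    simp only [Pi.add_apply, Pi.sub_apply, h1, h2, h3, h4, h5, h6, h7, h8]
    exact h)
  rw [integral_add' ((i1.sub i2).add i3) i4, integral_add' (i1.sub i2) i3, integral_sub' i1 i2,
    integral_add' i5 i6] at key
  simp only [integral_const_mul] at key
  rw [← norm_sub_sq_eq_integral, ← norm_sub_sq_eq_integral, ← norm_sub_sq_eq_integral,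
    ← norm_sub_sq_eq_integral, ← inner_sub_sub_eq_integral, ← inner_sub_sub_eq_integral] at key
  linarith

/-- The flux term in the pointwise bound cancels the right-hand side of the energy inequality,
leaving a telescoping quantity on the right. -/
theorem error_decay (P : MParams M M₀ LF τ ε) (S : SplitPair b B)
    (hF : ∀ s t, ‖F (b s) - F (b t)‖ ^ 2 ≤ LF * ((b s - b t) * (B s - B t)))
    (W : IsWeakSolution Ω F b B τ f uPrev sn un wn)
    (T : IsLinearizedStep Ω F b B (mFactor M τ ε b) (mFactor M τ ε B) τ f uPrev a s u w)
    (hC : ∀ᵐ x ∂(volume.restrict Ω), CloseData M₀ τ b B (a x) (sn x)) :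
    ε * M * τ * ‖s - a‖ ^ 2 + τ / 2 * ‖H10.grad (w - wn)‖ ^ 2
      ≤ mFloor M τ ε * (‖a - sn‖ ^ 2 - ‖s - sn‖ ^ 2) := by
  have := error_estimate P S hF W T (j := 0) (m := mFloor M τ ε) (n := mFloor M τ ε)
    (k := ε * M * τ) (by
    filter_upwards [hC] with x hx
    rw [zero_mul, add_zero]
    exact pairing_lower_degenerate P S hx (s x))
  linarith

theorem error_contraction_nondegenerate (P : MParams M M₀ LF τ ε) (S : SplitPair b B)
    (hF : ∀ s t, ‖F (b s) - F (b t)‖ ^ 2 ≤ LF * ((b s - b t) * (B s - B t)))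
    (W : IsWeakSolution Ω F b B τ f uPrev sn un wn)
    (T : IsLinearizedStep Ω F b B (mFactor M τ ε b) (mFactor M τ ε B) τ f uPrev a s u w)
    (hC : ∀ᵐ x ∂(volume.restrict Ω), CloseData M₀ τ b B (a x) (sn x))
    {ℓ : ℝ} (hb : ∀ t, ℓ ≤ deriv b t) (hB : ∀ t, ℓ ≤ deriv B t) :
    ℓ * ‖s - sn‖ ^ 2 + τ / 2 * ‖H10.grad (w - wn)‖ ^ 2 + ε * M * τ * ‖s - a‖ ^ 2
      ≤ M * τ * ‖a - sn‖ ^ 2 := by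
  have := error_estimate P S hF W T (j := 0) (m := ℓ) (n := M * τ) (k := ε * M * τ) (by
    filter_upwards [hC] with x hx
    rw [zero_mul, add_zero]
    exact pairing_lower_nondegenerate P S hx hb hB (s x))
  linarith

theorem error_contraction_single (P : MParams M M₀ LF τ ε) (S : SplitPair b B)
    (hF : ∀ s t, ‖F (b s) - F (b t)‖ ^ 2 ≤ LF * ((b s - b t) * (B s - B t)))
    (W : IsWeakSolution Ω F b B τ f uPrev sn un wn)
    (T : IsLinearizedStep Ω F b B (mFactor M τ ε b) (mFactor M τ ε B) τ f uPrev a s u w)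
    (hC : ∀ᵐ x ∂(volume.restrict Ω), CloseData M₀ τ b B (a x) (sn x))
    {C : ℝ} (hCpos : 0 < C) (hP : ∀ w : H10 Ω, ‖H10.fn w‖ ^ 2 ≤ C * ‖H10.grad w‖ ^ 2)
    {ℓ : ℝ} (hℓ : 0 ≤ ℓ) (hB : ∀ t, ℓ ≤ deriv B t) :
    ‖s - sn‖ ^ 2 + 1 / (8 * M) * ‖H10.grad (w - wn)‖ ^ 2
        + 4 * M * ε * (1 / (8 * M)) * ‖s - a‖ ^ 2
      ≤ (1 - ℓ ^ 2 * (min 1 (1 / (4 * M * C)) / 20)) * ‖a - sn‖ ^ 2 := by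
  have hM := P.M_pos
  have hτ := P.τ_pos
  have hε := P.ε_pos
  have hN := mFloor_pos P
  have hNle : mFloor M τ ε ≤ M * τ := mFloor_le
  have hℓ1 : ℓ ≤ 1 := (hB 0).trans (S.deriv_B_mem 0).2
  -- Chosen so that `κ * C ≤ 1 / (4 * M)`: the Poincaré cost of the w error is then at most half of
  -- the gradient term, which is worth `1 / (2 * M)` after division by `mFloor ≤ M * τ`.
  set κ := min 1 (1 / (4 * M * C)) with hκ
  have hκ0 : 0 ≤ κ := by positivity
  have hκ1 : κ ≤ 1 := min_le_left _ _
  have hκC : κ * C ≤ 1 / (4 * M) := by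
    have : κ ≤ 1 / (4 * M * C) := min_le_right _ _
    calc κ * C ≤ 1 / (4 * M * C) * C := mul_le_mul_of_nonneg_right this hCpos.le
      _ = 1 / (4 * M) := by field_simp
  have h1 := error_estimate P S hF W T (j := mFloor M τ ε * κ)
    (m := mFloor M τ ε * (1 + κ * ℓ / 4)) (n := mFloor M τ ε * (1 + κ * ℓ / 4 - κ * ℓ / 10))
    (k := ε * M * τ) (by
    filter_upwards [hC] with x hx
    have := pairing_lower_single P S hx hℓ hB hκ0 hκ1 (s x)
    linarith)
  have h2 : ‖H10.fn w - H10.fn wn‖ ^ 2 ≤ C * ‖H10.grad (w - wn)‖ ^ 2 := hP (w - wn)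
  generalize ‖H10.fn w - H10.fn wn‖ ^ 2 = W2 at *
  have hG : 0 ≤ ‖H10.grad (w - wn)‖ ^ 2 := sq_nonneg _
  have hD : 0 ≤ ‖s - a‖ ^ 2 := sq_nonneg _
  have hY : 0 ≤ ‖s - sn‖ ^ 2 := sq_nonneg _
  have hX : 0 ≤ ‖a - sn‖ ^ 2 := sq_nonneg _
  generalize ‖H10.grad (w - wn)‖ ^ 2 = G at *
  generalize ‖s - a‖ ^ 2 = D at *
  generalize ‖s - sn‖ ^ 2 = Y at *
  generalize ‖a - sn‖ ^ 2 = X at *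
  generalize mFloor M τ ε = N at *
  have h3 : κ * W2 ≤ 1 / (4 * M) * G := by
    calc κ * W2 ≤ κ * (C * G) := mul_le_mul_of_nonneg_left h2 hκ0
      _ = κ * C * G := by ring
      _ ≤ _ := mul_le_mul_of_nonneg_right hκC hG
  have h4 : N * (1 / (2 * M) * G) ≤ τ / 2 * G := by
    have : N * (1 / (2 * M)) ≤ τ / 2 := by
      rw [mul_one_div, div_le_iff₀ (by positivity)]; linarith
    calc N * (1 / (2 * M) * G) = N * (1 / (2 * M)) * G := by ring
      _ ≤ _ := mul_le_mul_of_nonneg_right this hG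
  have h5 : N * (ε * D) ≤ ε * M * τ * D := by
    calc N * (ε * D) ≤ M * τ * (ε * D) := mul_le_mul_of_nonneg_right hNle (by positivity)
      _ = _ := by ring
  have h6 : N * ((1 + κ * ℓ / 4) * Y - (1 + κ * ℓ / 4 - κ * ℓ / 10) * X + ε * D
      + 1 / (2 * M) * G - 1 / (4 * M) * G) ≤ 0 := by
    have := mul_le_mul_of_nonneg_left h3 hN.le
    linarith
  have h7 : (1 + κ * ℓ / 4) * Y - (1 + κ * ℓ / 4 - κ * ℓ / 10) * X + ε * D
      + 1 / (2 * M) * G - 1 / (4 * M) * G ≤ 0 := by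
    by_contra! hcon
    linarith [mul_pos hN hcon]
  have hμ : 0 ≤ κ * ℓ := mul_nonneg hκ0 hℓ
  have hμ1 : κ * ℓ ≤ 1 := mul_le_one₀ hκ1 hℓ hℓ1
  have e1 : 4 * M * ε * (1 / (8 * M)) = ε / 2 := by field_simp; norm_num
  have e2 : 1 / (2 * M) * G = 4 * (1 / (8 * M) * G) := by field_simp; ring
  have e3 : 1 / (4 * M) * G = 2 * (1 / (8 * M) * G) := by field_simp; ring
  have hg : 0 ≤ 1 / (8 * M) * G := by positivity
  rw [e2, e3] at h7
  rw [e1]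
  generalize 1 / (8 * M) * G = g at *
  -- The argument yields the stronger rate `1 - κ * ℓ / 20`; `ℓ ≤ 1` weakens it to `ℓ^2`.
  have h8 : ℓ ^ 2 * (κ / 20) ≤ κ * ℓ / 20 := by nlinarith
  have h9 := mul_le_mul_of_nonneg_right h8 hX
  generalize κ * ℓ = μ at *
  have hεD : 0 ≤ ε * D := by positivity
  suffices Y + g + ε / 2 * D ≤ (1 - μ / 20) * X by linarith
  -- With `0 ≤ μ ≤ 1`, `(1 + μ / 4) * (1 - μ / 20) ≥ 1 + μ / 4 - μ / 10`, while the factor `1 + μ /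
  -- 4 ≤ 5 / 4` is covered by the spare `2 * g` and `ε * D`.
  have h10 : (1 + μ / 4) * (Y + g + ε / 2 * D) ≤ (1 + μ / 4) * ((1 - μ / 20) * X) := by
    nlinarith [mul_nonneg hμ hg, mul_nonneg hμ hεD, mul_nonneg hμ hX,
      mul_le_mul_of_nonneg_right hμ1 hg, mul_le_mul_of_nonneg_right hμ1 hεD,
      mul_nonneg (mul_nonneg hμ (sub_nonneg.2 hμ1)) hX]
  exact le_of_mul_le_mul_left h10 (by linarith)

end Ae

end Energy

end DoubleSplitting

namespace DoubleSplitting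

/-! ## Convergence in the doubly degenerate case -/

/-- The sequence `y` is decreasing and bounded below, hence convergent, so its successive
differences vanish. -/
theorem tendsto_zero_of_le_mul_sub {y r : ℕ → ℝ} {c : ℝ} (hc : 0 < c) (hy : ∀ i, 0 ≤ y i)
    (hr : ∀ i, 0 ≤ r i) (h : ∀ i, r i ≤ c * (y i - y (i + 1))) : Tendsto r atTop (𝓝 0) := by
  have hanti : Antitone y := antitone_nat_of_succ_le fun i =>
    sub_nonneg.1 (nonneg_of_mul_nonneg_right ((hr i).trans (h i)) hc)
  have hlim := tendsto_atTop_ciInf hanti ⟨0, by rintro _ ⟨i, rfl⟩; exact hy i⟩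
  have h2 := (hlim.sub (hlim.comp (tendsto_add_atTop_nat 1))).const_mul c
  rw [sub_self, mul_zero] at h2
  exact squeeze_zero hr h h2

theorem tendsto_norm_of_tendsto_norm_sq {E : Type*} [SeminormedAddCommGroup E] {v : ℕ → E}
    (h : Tendsto (fun i => ‖v i‖ ^ 2) atTop (𝓝 0)) : Tendsto (fun i => ‖v i‖) atTop (𝓝 0) := by
  have := (Real.continuous_sqrt.tendsto 0).comp h
  simpa [Function.comp_def, Real.sqrt_sq (norm_nonneg _)] using this

theorem tendsto_inner_of_denseRange {E ι : Type*} [NormedAddCommGroup E] [InnerProductSpace ℝ E]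
    {g : ι → E} (hg : DenseRange g) {e : ℕ → E} {R : ℝ} (hR : ∀ i, ‖e i‖ ≤ R)
    (h : ∀ k, Tendsto (fun i => inner ℝ (e i) (g k)) atTop (𝓝 0)) (v : E) :
    Tendsto (fun i => inner ℝ (e i) v) atTop (𝓝 0) := by
  have hR0 : 0 ≤ R := (norm_nonneg _).trans (hR 0)
  rw [Metric.tendsto_atTop]
  intro η hη
  obtain ⟨k, hk⟩ := hg.exists_dist_lt v (show 0 < η / (2 * (R + 1)) by positivity)
  obtain ⟨N, hN⟩ := Metric.tendsto_atTop.1 (h k) (η / 2) (by positivity)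
  refine ⟨N, fun i hi => ?_⟩
  have h1 := hN i hi
  rw [Real.dist_eq, sub_zero] at h1 ⊢
  have h2 : inner ℝ (e i) v = inner ℝ (e i) (g k) + inner ℝ (e i) (v - g k) := by
    rw [← inner_add_right, add_sub_cancel]
  have h3 : |inner ℝ (e i) (v - g k)| ≤ η / 2 := by
    refine (abs_real_inner_le_norm _ _).trans ?_
    rw [← dist_eq_norm]
    calc ‖e i‖ * dist v (g k) ≤ (R + 1) * (η / (2 * (R + 1))) :=
          mul_le_mul ((hR i).trans (by linarith)) hk.le dist_nonneg (by positivity)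
      _ = η / 2 := by field_simp
  rw [h2]
  exact (abs_add_le _ _).trans_lt (by linarith)

section Convergence

variable {d : ℕ} {Ω : Set (EuclideanSpace ℝ (Fin d))} [IsFiniteMeasure (volume.restrict Ω)]

theorem exists_integral_abs_le :
    ∃ C : ℝ, ∀ g : L2 Ω, ∫ x in Ω, |g x| ≤ C * ‖g‖ := by
  have hm : MemLp (fun _ => (1 : ℝ)) 2 (volume.restrict Ω) := memLp_const 1
  refine ⟨‖hm.toLp _‖, fun g => ?_⟩
  have h := real_inner_le_norm (hm.toLp _) |g|
  rw [norm_abs_eq_norm, L2.inner_def] at h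
  refine le_of_eq_of_le (integral_congr_ae ?_) h
  filter_upwards [hm.coeFn_toLp, Lp.coeFn_abs g] with x h1 h2
  rw [h1, h2]
  simp

theorem exists_inner_eq_integral : ∃ v : L2 Ω, ∀ g : L2 Ω, inner ℝ g v = ∫ x in Ω, g x := by
  have hm : MemLp (fun _ => (1 : ℝ)) 2 (volume.restrict Ω) := memLp_const 1
  refine ⟨hm.toLp _, fun g => ?_⟩
  rw [L2.inner_def]
  refine integral_congr_ae ?_
  filter_upwards [hm.coeFn_toLp] with x h1
  rw [h1]
  simp

variable {F : ℝ → EuclideanSpace ℝ (Fin d)} {b B : ℝ → ℝ} {M M₀ LF τ ε : ℝ} {f : HMinusOne Ω}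
  {uPrev sn un : L2 Ω} {wn : H10 Ω} {s u : ℕ → L2 Ω} {w : ℕ → H10 Ω}

/-- If `B(sᵢ) → B(s)` in `L²` and `B` increases strictly to the right of the values of `s`, then
the positive parts of `b(sᵢ) - b(s)` tend to zero in `L¹`. -/
theorem tendsto_integral_posPart (S : SplitPair b B) {R : ℝ}
    (hbd : ∀ i, ∀ᵐ x ∂(volume.restrict Ω), |s i x - sn x| ≤ R)
    (hlt : ∀ᵐ x ∂(volume.restrict Ω), ∀ t, sn x < t → B (sn x) < B t)
    (hB : Tendsto (fun i => ‖S.symm.toL2 (s i) - S.symm.toL2 sn‖) atTop (𝓝 0)) :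
    Tendsto (fun i => ∫ x in Ω, max (b (s i x) - b (sn x)) 0) atTop (𝓝 0) := by
  -- Every subsequence has a further one along which `B(sᵢ) → B(s)` almost everywhere; dominated
  -- convergence applies there with the uniform bound `R`.
  refine tendsto_of_subseq_tendsto fun ns hns => ?_
  have h1 : Tendsto (fun n => S.symm.toL2 (s (ns n))) atTop (𝓝 (S.symm.toL2 sn)) := by
    rw [tendsto_iff_norm_sub_tendsto_zero]
    exact hB.comp hns
  obtain ⟨ms, -, hms⟩ := (tendstoInMeasure_of_tendsto_Lp h1).exists_seq_tendsto_ae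
  refine ⟨ms, ?_⟩
  have hall : ∀ᵐ x ∂(volume.restrict Ω), ∀ i, |s i x - sn x| ≤ R := ae_all_iff.2 hbd
  have hval : ∀ᵐ x ∂(volume.restrict Ω), ∀ i, S.symm.toL2 (s i) x = B (s i x) :=
    ae_all_iff.2 fun i => S.symm.coeFn_toL2 (s i)
  have hle : ∀ p q : ℝ, max (b p - b q) 0 ≤ max (p - q) 0 := fun p q => by
    refine max_le ?_ (le_max_right _ _)
    rcases le_total p q with h | h
    · exact le_max_of_le_right (sub_nonpos.2 (S.monotone_b h))
    · refine le_max_of_le_left ((le_abs_self _).trans ((S.abs_sub_le p q).trans ?_))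
      rw [abs_of_nonneg (sub_nonneg.2 h)]
  have key := tendsto_integral_of_dominated_convergence (μ := volume.restrict Ω)
    (F := fun n x => max (b (s (ns (ms n)) x) - b (sn x)) 0) (f := fun _ => 0) (fun _ => R)
    (fun n => (((S.memLp_b (s (ns (ms n)))).sub (S.memLp_b sn)).aestronglyMeasurable.sup
      aestronglyMeasurable_const)) (integrable_const R) (fun n => by
      filter_upwards [hall] with x hx
      rw [Real.norm_of_nonneg (le_max_right _ _)]
      exact (hle _ _).trans (max_le ((le_abs_self _).trans (hx _)) ((abs_nonneg _).trans (hx 0))))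
    (by
      filter_upwards [hms, hval, hlt, S.symm.coeFn_toL2 sn] with x h2 h3 h4 h5
      simp only [h3, h5] at h2
      rw [Metric.tendsto_atTop]
      intro η hη
      -- Since `B(s) < B(s + η)`, eventually `B(sᵢ) < B(s + η)`, and monotonicity gives `sᵢ < s +
      -- η`. Nothing comparable holds from below, because `B` may be flat to the left of `s`.
      have h6 := h2.eventually (gt_mem_nhds (h4 (sn x + η) (by linarith)))
      obtain ⟨N, hN⟩ := eventually_atTop.1 h6
      refine ⟨N, fun n hn => ?_⟩
      rw [Real.dist_eq, sub_zero, abs_of_nonneg (le_max_right _ _)]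
      have h7 := S.monotone_B.reflect_lt (hN n hn)
      exact (hle _ _).trans_lt (max_lt (by linarith) hη))
  simpa using key

theorem tendsto_error (hΩ : IsOpen Ω) {C : ℝ}
    (hP : ∀ w : H10 Ω, ‖H10.fn w‖ ^ 2 ≤ C * ‖H10.grad w‖ ^ 2)
    (P : MParams M M₀ LF τ ε) (S : SplitPair b B)
    (hF : ∀ s t, ‖F (b s) - F (b t)‖ ^ 2 ≤ LF * ((b s - b t) * (B s - B t)))
    (W : IsWeakSolution Ω F b B τ f uPrev sn un wn)
    (T : ∀ i, IsLinearizedStep Ω F b B (mFactor M τ ε b) (mFactor M τ ε B) τ f uPrev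
      (s i) (s (i + 1)) (u (i + 1)) (w (i + 1)))
    (hC : ∀ i, ∀ᵐ x ∂(volume.restrict Ω), CloseData M₀ τ b B (s i x) (sn x))
    {R : ℝ} (hbd : ∀ i, ∀ᵐ x ∂(volume.restrict Ω), |s i x - sn x| ≤ R)
    (hlt : ∀ᵐ x ∂(volume.restrict Ω), ∀ t, sn x < t → B (sn x) < B t) :
    Tendsto (fun i : ℕ => (∫ x in Ω, |s i x - sn x|) + (∫ x in Ω, |u i x - un x|)
        + H10.h1Norm (w i - wn)) atTop (𝓝 0) := by
  have hM := P.M_pos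
  have hτ := P.τ_pos
  have hε := P.ε_pos
  have hLF := P.LF_pos
  have hN := mFloor_pos P
  -- decay of the increments and of the gradients
  have hdec := fun i => error_decay P S hF W (T i) (hC i)
  have hδ2 : Tendsto (fun i => ‖s (i + 1) - s i‖ ^ 2) atTop (𝓝 0) := by
    have := tendsto_zero_of_le_mul_sub (y := fun i => ‖s i - sn‖ ^ 2)
      (r := fun i => ε * M * τ * ‖s (i + 1) - s i‖ ^ 2) hN (fun i => sq_nonneg _)
      (fun i => by positivity) fun i => le_trans (le_add_of_nonneg_right (by positivity)) (hdec i)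
    have h := this.const_mul (ε * M * τ)⁻¹
    rw [mul_zero] at h
    exact h.congr fun i => inv_mul_cancel_left₀ (by positivity) _
  have hG2 : Tendsto (fun i => ‖H10.grad (w (i + 1) - wn)‖ ^ 2) atTop (𝓝 0) := by
    have := tendsto_zero_of_le_mul_sub (y := fun i => ‖s i - sn‖ ^ 2)
      (r := fun i => τ / 2 * ‖H10.grad (w (i + 1) - wn)‖ ^ 2) hN (fun i => sq_nonneg _)
      (fun i => by positivity) fun i => le_trans (le_add_of_nonneg_left (by positivity)) (hdec i)
    have h := this.const_mul (τ / 2)⁻¹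
    rw [mul_zero] at h
    exact h.congr fun i => inv_mul_cancel_left₀ (by positivity) _
  have hW2 : Tendsto (fun i => ‖H10.fn (w (i + 1) - wn)‖ ^ 2) atTop (𝓝 0) := by
    refine squeeze_zero (fun i => sq_nonneg _) (fun i => hP _) ?_
    simpa using hG2.const_mul C
  have hδ := tendsto_norm_of_tendsto_norm_sq hδ2
  have hG := tendsto_norm_of_tendsto_norm_sq hG2
  have hW := tendsto_norm_of_tendsto_norm_sq hW2
  have hεδ : Tendsto (fun i => (1 + ε) * ‖s (i + 1) - s i‖) atTop (𝓝 0) := by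
    simpa using hδ.const_mul (1 + ε)
  have hY : ∀ i, ‖s i - sn‖ ≤ ‖s 0 - sn‖ := by
    intro i
    induction i with
    | zero => exact le_rfl
    | succ i ih =>
      refine le_trans ?_ ih
      have h1 : 0 ≤ mFloor M τ ε * (‖s i - sn‖ ^ 2 - ‖s (i + 1) - sn‖ ^ 2) :=
        le_trans (by positivity) (hdec i)
      have h2 := nonneg_of_mul_nonneg_right h1 hN
      exact abs_le_of_sq_le_sq' (sub_nonneg.1 h2) (norm_nonneg _) |>.2
  -- `B(sᵢ) → B(s)` in `L²`
  have hunL : un = S.toL2 sn := Lp.ext ((W.u_ae S).trans (S.coeFn_toL2 sn).symm)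
  have hwnL : H10.fn wn = S.symm.toL2 sn := Lp.ext ((W.w_ae S).trans (S.symm.coeFn_toL2 sn).symm)
  have hBlim : Tendsto (fun i => ‖S.symm.toL2 (s i) - S.symm.toL2 sn‖) atTop (𝓝 0) := by
    refine squeeze_zero (fun i => norm_nonneg _) (fun i => ?_) (by simpa using hW.add hεδ)
    have h1 := (T i).norm_w_sub_le P S
    have h2 : S.symm.toL2 (s i) - S.symm.toL2 sn
        = H10.fn (w (i + 1) - wn) - (H10.fn (w (i + 1)) - S.symm.toL2 (s i)) := by
      rw [show H10.fn (w (i + 1) - wn) = H10.fn (w (i + 1)) - H10.fn wn from rfl, hwnL]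
      abel
    rw [h2]
    exact (norm_sub_le _ _).trans (add_le_add_right h1 _)
  -- weak convergence of `uᵢ`
  have hFlim : Tendsto (fun i => ‖(memLp_flux S hLF.le hF (s i)).toLp _
      - (memLp_flux S hLF.le hF sn).toLp _‖) atTop (𝓝 0) := by
    refine tendsto_norm_of_tendsto_norm_sq (squeeze_zero (fun i => sq_nonneg _) (fun i => ?_)
      (by simpa using hBlim.const_mul (LF * ‖s 0 - sn‖)))
    -- Only the `B` factor tends to zero; the `b` factor merely stays bounded by the initial error.
    refine (norm_flux_sub_sq_le S hLF.le hF (s i) sn).trans ?_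
    rw [mul_assoc]
    refine mul_le_mul_of_nonneg_left ((real_inner_le_norm _ _).trans ?_) hLF.le
    exact mul_le_mul_of_nonneg_right ((S.norm_toL2_sub_le _ _).trans (hY i)) (norm_nonneg _)
  have hutest : ∀ φ : H10 Ω,
      Tendsto (fun i => inner ℝ (u (i + 1) - un) (H10.fn φ)) atTop (𝓝 0) := by
    intro φ
    refine squeeze_zero_norm (fun i => ?_)
      (by simpa using (((hFlim.add hG).mul_const ‖H10.grad φ‖).const_mul τ))
    have h1 := error_balance S hLF.le hF W (T i) φ
    have h2 : inner ℝ (u (i + 1) - un) (H10.fn φ)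
        = τ * (inner ℝ ((memLp_flux S hLF.le hF (s i)).toLp _
            - (memLp_flux S hLF.le hF sn).toLp _) (H10.grad φ)
          - inner ℝ (H10.grad (w (i + 1) - wn)) (H10.grad φ)) := by
      rw [← h1]
      field_simp
      ring
    rw [h2, norm_mul, Real.norm_of_nonneg hτ.le, add_mul]
    refine mul_le_mul_of_nonneg_left ((norm_sub_le _ _).trans ?_) hτ.le
    exact add_le_add (norm_inner_le_norm _ _) (norm_inner_le_norm _ _)
  have hubd : ∀ i, ‖u (i + 1) - S.toL2 (s i)‖ ≤ (1 + ε) * ‖s (i + 1) - s i‖ := fun i =>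
    (T i).norm_u_sub_le P S
  obtain ⟨K, hK⟩ := hεδ.bddAbove_range
  have hweak := tendsto_inner_of_denseRange (denseRange_fn hΩ) (e := fun i => u (i + 1) - un)
    (R := K + ‖s 0 - sn‖) (fun i => by
      have h1 : u (i + 1) - un = (u (i + 1) - S.toL2 (s i)) + (S.toL2 (s i) - S.toL2 sn) := by
        rw [hunL]; abel
      rw [h1]
      exact (norm_add_le _ _).trans (add_le_add ((hubd i).trans (hK ⟨i, rfl⟩))
        ((S.norm_toL2_sub_le _ _).trans (hY i)))) hutest
  -- `b(sᵢ) → b(s)` in `L¹`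
  obtain ⟨v, hv⟩ := exists_inner_eq_integral (Ω := Ω)
  obtain ⟨C₁, hC₁⟩ := exists_integral_abs_le (Ω := Ω)
  have hbint : Tendsto (fun i => ∫ x in Ω, (b (s i x) - b (sn x))) atTop (𝓝 0) := by
    have h1 : Tendsto (fun i => inner ℝ (u (i + 1) - S.toL2 (s i)) v) atTop (𝓝 0) :=
      squeeze_zero_norm (fun i => (norm_inner_le_norm _ _).trans
        (mul_le_mul_of_nonneg_right (hubd i) (norm_nonneg _)))
        (by simpa using hεδ.mul_const ‖v‖)
    have h2 := (hweak v).sub h1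
    rw [sub_zero] at h2
    refine h2.congr fun i => ?_
    rw [← inner_sub_left, hunL, sub_sub_sub_cancel_left, hv]
    exact integral_congr_ae (S.coeFn_toL2_sub _ _)
  have hpos := tendsto_integral_posPart S hbd hlt hBlim
  have hbi : ∀ i, Integrable (fun x => b (s i x) - b (sn x)) (volume.restrict Ω) := fun i =>
    ((S.memLp_b (s i)).sub (S.memLp_b sn)).integrable one_le_two
  have hb1 : Tendsto (fun i => ∫ x in Ω, |b (s i x) - b (sn x)|) atTop (𝓝 0) := by
    -- Based on `|z| = 2 * max z 0 - z`: the positive part and the mean both vanish in the limit.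
    have h1 := (hpos.const_mul 2).sub hbint
    rw [mul_zero, sub_zero] at h1
    refine h1.congr fun i => ?_
    rw [← integral_const_mul, ← integral_sub ((hbi i).pos_part.const_mul 2) (hbi i)]
    refine integral_congr_ae (Eventually.of_forall fun x => ?_)
    simp only
    rcases le_total 0 (b (s i x) - b (sn x)) with h | h
    · rw [max_eq_left h, abs_of_nonneg h]; ring
    · rw [max_eq_right h, abs_of_nonpos h]; ring
  have hB1 : Tendsto (fun i => ∫ x in Ω, |B (s i x) - B (sn x)|) atTop (𝓝 0) := by
    refine squeeze_zero (fun i => integral_nonneg fun x => abs_nonneg _) (fun i => ?_)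
      (by simpa using hBlim.const_mul C₁)
    refine le_of_eq_of_le (integral_congr_ae ?_) (hC₁ _)
    filter_upwards [S.symm.coeFn_toL2_sub (s i) sn] with x hx
    rw [hx]
  have hs1 : Tendsto (fun i => ∫ x in Ω, |s i x - sn x|) atTop (𝓝 0) := by
    refine squeeze_zero (fun i => integral_nonneg fun x => abs_nonneg _) (fun i => ?_)
      (by simpa using hb1.add hB1)
    have hBi : Integrable (fun x => B (s i x) - B (sn x)) (volume.restrict Ω) :=
      ((S.symm.memLp_b (s i)).sub (S.symm.memLp_b sn)).integrable one_le_two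
    rw [← integral_add (hbi i).abs hBi.abs]
    exact integral_mono_ae (((Lp.memLp (s i)).sub (Lp.memLp sn)).integrable one_le_two).abs
      ((hbi i).abs.add hBi.abs) (Eventually.of_forall fun x => S.abs_sub_le_add _ _)
  have hu1 : Tendsto (fun i => ∫ x in Ω, |u (i + 1) x - un x|) atTop (𝓝 0) := by
    refine squeeze_zero (fun i => integral_nonneg fun x => abs_nonneg _) (fun i => ?_)
      (g := fun i => |C₁| * ((1 + ε) * ‖s (i + 1) - s i‖) + ∫ x in Ω, |b (s i x) - b (sn x)|)
      (by simpa using (hεδ.const_mul |C₁|).add hb1)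
    have hi1 : Integrable (fun x => |(u (i + 1) - S.toL2 (s i) : L2 Ω) x|)
        (volume.restrict Ω) := ((Lp.memLp _).integrable one_le_two).abs
    have h1 : ∫ x in Ω, |u (i + 1) x - un x| ≤ ∫ x in Ω,
        (|(u (i + 1) - S.toL2 (s i) : L2 Ω) x| + |b (s i x) - b (sn x)|) := by
      refine integral_mono_ae
        (((Lp.memLp (u (i + 1))).sub (Lp.memLp un)).integrable one_le_two).abs
        (hi1.add (hbi i).abs) ?_
      filter_upwards [W.u_ae S, S.coeFn_toL2 (s i), Lp.coeFn_sub (u (i + 1)) (S.toL2 (s i))]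
        with x h2 h3 h4
      rw [h4, Pi.sub_apply, h2, h3]
      exact abs_sub_le _ _ _
    rw [integral_add hi1 (hbi i).abs] at h1
    refine h1.trans (add_le_add_left ((hC₁ _).trans ?_) _)
    exact (mul_le_mul_of_nonneg_right (le_abs_self _) (norm_nonneg _)).trans
      (mul_le_mul_of_nonneg_left (hubd i) (abs_nonneg _))
  have hw1 : Tendsto (fun i => H10.h1Norm (w (i + 1) - wn)) atTop (𝓝 0) := by
    have := (Real.continuous_sqrt.tendsto 0).comp (by simpa using hW2.add hG2)
    simpa [Function.comp_def, H10.h1Norm] using this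
  -- The scheme does not determine `u 0` and `w 0`, so the limit is taken from index 1 on.
  rw [← tendsto_add_atTop_iff_nat 1]
  simpa using ((hs1.comp (tendsto_add_atTop_nat 1)).add hu1).add hw1

end Convergence

end DoubleSplitting

/-! ### The convergence theorem -/

theorem theorem3p3 {d : ℕ} (hd : 0 < d) (Ω : Set (EuclideanSpace ℝ (Fin d)))
    (hΩo : IsOpen Ω) (hΩb : Bornology.IsBounded Ω) (M : ℝ) :
    -- the constants of the single-degenerate case depend on `Ω` and `M` only
    ∃ Θ ϱ : ℝ, 0 < Θ ∧ 0 < ϱ ∧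
      ∀ (umax : EReal) (Φ : ℝ → ℝ) (ustar : ℝ) (b B : ℝ → ℝ)
        (F : ℝ → EuclideanSpace ℝ (Fin d)) (LF : ℝ) (f : HMinusOne Ω) (uPrev : L2 Ω)
        (Λ τ ε M₀ : ℝ)
        (sn un : L2 Ω) (wn : H10 Ω) (s u : ℕ → L2 Ω) (w : ℕ → H10 Ω),
      DiffusionAssumption umax Φ →
      RegularityAssumption umax Φ ustar →
      b = bFun umax Φ ustar → B = BFun Φ ustar →
      IsDecomposition umax Φ b B →
      (∃ K : ℝ≥0, LipschitzWith K (deriv b)) → (∃ K : ℝ≥0, LipschitzWith K (deriv B)) →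
      FluxAssumption umax Φ F LF →
      0 < Λ →
      M₀ = Λ * max (lipConst (deriv b)) (lipConst (deriv B)) →
      M₀ + LF < M →
      0 < τ → τ < min (1 / (M + M₀)) (1 / LF) →
      0 < ε → ε < (M - M₀ - LF) * τ →
      IsWeakSolution Ω F b B τ f uPrev sn un wn →
      (∀ i : ℕ, IsLinearizedStep Ω F b B (mFactor M τ ε b) (mFactor M τ ε B) τ f uPrev
        (s i) (s (i + 1)) (u (i + 1)) (w (i + 1))) →
      (∀ i : ℕ, eLpNorm (fun x => s i x - sn x) ⊤ (volume.restrict Ω)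
        ≤ ENNReal.ofReal (Λ * τ)) →
      -- `Φ` is given on `[0, umax)` only; negative values of `un` are admitted when the chosen
      -- extension of `Φ` is strictly increasing
      ((∀ᵐ x ∂(volume.restrict Ω), 0 ≤ un x) ∨ StrictMonoOn Φ (Set.Iio 0)) →
      -- convergence in the general, doubly degenerate case
      Tendsto (fun i : ℕ => (∫ x in Ω, |s i x - sn x|) + (∫ x in Ω, |u i x - un x|)
        + H10.h1Norm (w i - wn)) atTop (𝓝 0) ∧
      -- the single-degenerate case
      (0 < (⨅ t : ℝ, deriv B t) →
        ∀ i : ℕ, ‖s (i + 1) - sn‖ ^ 2 + ϱ * ‖H10.grad (w (i + 1) - wn)‖ ^ 2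
            + 4 * M * ε * ϱ * ‖s (i + 1) - s i‖ ^ 2
          ≤ (1 - (⨅ t : ℝ, deriv B t) ^ 2 * Θ) * ‖s i - sn‖ ^ 2) ∧
      -- the non-degenerate case
      (0 < min (⨅ t : ℝ, deriv b t) (⨅ t : ℝ, deriv B t) →
        ∀ i : ℕ, min (⨅ t : ℝ, deriv b t) (⨅ t : ℝ, deriv B t) * ‖s (i + 1) - sn‖ ^ 2
            + τ / 2 * ‖H10.grad (w (i + 1) - wn)‖ ^ 2
            + ε * M * τ * ‖s (i + 1) - s i‖ ^ 2
          ≤ M * τ * ‖s i - sn‖ ^ 2) := by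
  obtain ⟨C, hCpos, hP⟩ := exists_poincare hd hΩb
  have : IsFiniteMeasure (volume.restrict Ω) :=
    ⟨by rw [Measure.restrict_apply_univ]; exact hΩb.measure_lt_top⟩
  rcases le_or_gt M 0 with hM | hM
  -- For `M ≤ 0` the hypotheses contradict each other, since `0 < M₀ + LF < M`; the constants,
  -- chosen beforehand, are arbitrary.
  · refine ⟨1, 1, one_pos, one_pos, ?_⟩
    intro umax Φ ustar b B F LF f uPrev Λ τ ε M₀ sn un wn s u w _ _ _ _ _ _ _ hF hΛ hM₀ hlt
    have h1 : 0 ≤ M₀ := by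
      rw [hM₀]; exact mul_nonneg hΛ.le (le_max_of_le_left (lipConst_nonneg _))
    linarith [hF.pos]
  refine ⟨min 1 (1 / (4 * M * C)) / 20, 1 / (8 * M), by positivity, by positivity, ?_⟩
  intro umax Φ ustar b B F LF f uPrev Λ τ ε M₀ sn un wn s u w hΦ hR hb hB D hLb hLB hF hΛ hM₀
    hlt hτ hτlt hε hεlt W T hbd hsign
  have S := D.splitPair hb hB
  have hM₀0 : 0 ≤ M₀ := by
    rw [hM₀]; exact mul_nonneg hΛ.le (le_max_of_le_left (lipConst_nonneg _))
  have P : MParams M M₀ LF τ ε := by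
    refine ⟨hM₀0, hF.pos, hlt, hτ, ?_, ?_, hε, hεlt⟩
    · have := hτlt.trans_le (min_le_left _ _)
      rwa [lt_div_iff₀ (by linarith), mul_comm] at this
    · have := hτlt.trans_le (min_le_right _ _)
      rwa [lt_div_iff₀ hF.pos, mul_comm] at this
  have hFb := flux_comp_bound D S hF
  have hbd' : ∀ i, ∀ᵐ x ∂(volume.restrict Ω), |s i x - sn x| ≤ Λ * τ := by
    intro i
    have h1 := hbd i
    rw [eLpNorm_exponent_top] at h1
    filter_upwards [ae_le_eLpNormEssSup (f := fun x => s i x - sn x)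
      (μ := volume.restrict Ω)] with x hx
    have h2 := hx.trans h1
    rwa [← ofReal_norm, ENNReal.ofReal_le_ofReal_iff (by positivity),
      Real.norm_eq_abs] at h2
  have hC : ∀ i, ∀ᵐ x ∂(volume.restrict Ω), CloseData M₀ τ b B (s i x) (sn x) := fun i => by
    filter_upwards [hbd' i] with x hx
    rw [hM₀]
    exact closeData_of_abs_sub_le S hLb hLB hx
  have hinf : ∀ {b B : ℝ → ℝ}, SplitPair b B → ∀ t, (⨅ t : ℝ, deriv b t) ≤ deriv b t :=
    fun S t => ciInf_le ⟨0, by rintro _ ⟨r, rfl⟩; exact (S.deriv_b_mem r).1⟩ t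
  refine ⟨?_, ?_, ?_⟩
  · refine tendsto_error hΩo hP P S hFb W T hC hbd' ?_
    -- The sign hypothesis is recast as `0 ≤ un x` whenever the extension is not strictly
    -- increasing; then `sn x ≥ 0`, because `b` is the identity on negative arguments.
    filter_upwards [W.u_ae S, hsign.elim (fun h => h.mono fun x hx _ => hx)
      (fun h => Eventually.of_forall fun x h' => absurd h h')] with x h1 h2 t ht
    refine B_lt_of_lt hΦ hR hB S ht ?_
    by_cases h : StrictMonoOn Φ (Set.Iio 0)
    · exact Or.inr h
    · exact Or.inl (nonneg_of_b_nonneg hR hb (h1 ▸ h2 h))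
  · intro hℓ i
    exact error_contraction_single P S hFb W (T i) (hC i) hCpos hP hℓ.le (hinf S.symm)
  · intro _ i
    exact error_contraction_nondegenerate P S hFb W (T i) (hC i)
      (fun t => (min_le_left _ _).trans (hinf S t))
      (fun t => (min_le_right _ _).trans (hinf S.symm t))
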